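/- **Setting.** Let $(\mathbf S,\mathbf M)$ be a marked surface with a triangulation $T$: $\mathbf S$ is obtained from finitely many triangles by gluing some of their sides in pairs, $\mathbf M$ is the set of corners, the glued sides are the arcs of $T$ and the other sides are the boundary arcs. To every arc or boundary arc $\tau$ attach $x_\tau>0$, and to every arc $\tau$ attach $y_\tau>0$, elements of an ordered field (for instance $\mathbb R$, or a field of rational functions in the $x_\tau,y_\tau$, suitably ordered). *Principal lamination.* $\mathcal L_T=\{L_\tau\}$, where $L_\tau$ runs along the arc $\tau$, crosses it once, and turns at both ends around the endpoint of $\tau$, clockwise at both ends or counterclockwise at both ends with respect to an orientation along $\tau$, until it ends on the boundary (so that there are no punctures). For an orientation of the quadrilateral $Q_\tau$ formed by the two triangles at $\tau$, the shear coordinate $b_T(L_\tau,\tau)$ is the number of S-intersections of $L_\tau$ with $Q_\tau$ (it turns right and then left, meeting opposite sides of $Q_\tau$) minus the number of Z-intersections (left and then right). It changes sign with the orientation. *M-paths.* Choose a local orientation at every marked point $m$; let $h_m$ be a small horocycle at $m$, and for an arc or boundary arc $\tau$ ending at $m$ let $v^{+}_{m,\tau}$ (resp. $v^-_{m,\tau}$)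 be a point of $h_m$ close to $\tau$ in clockwise (resp. counterclockwise) direction from $\tau$. The elementary steps and their matrices are: 1. inside a triangle with sides $\tau,\tau',\sigma$, going along $h_m$ from $\tau$ to $\tau'$: $\begin{pmatrix}1&0\\ \pm\frac{x_\sigma}{x_\tau x_{\tau'}}&1\end{pmatrix}$, with sign $+$ if and only if the step is clockwise; 2. crossing $\tau$ along $h_m$: with $b=b_T(L_\tau,\tau)$ computed for the local orientation at $m$, $\mathrm{diag}(y_\tau^{\delta_{-1,b}},y_\tau^{\delta_{1,b}})$ if the step is clockwise and $\mathrm{diag}(y_\tau^{\delta_{1,b}},y_\tau^{\delta_{-1,b}})$ otherwise; 3. going parallel to $\tau$, on one side of it, to its other end $m'$, where the local orientations at $m$ and $m'$ agree along $\tau$ (from $v^\pm_{m,\tau}$ to $v^\mp_{m',\tau}$): $\pm\begin{pmatrix}0&x_\tau\\-\frac1{x_\tau}&0\end{pmatrix}$; 3'. the same where these local orientations disagree (from $v^\pm_{m,\tau}$ to $v^\pm_{m',\tau}$, through the crosscap): $\pm\begin{pmatrix}0&x_\tau\\\frac1{x_\tau}&0\end{pmatrix}$. In 3 and 3' the sign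 is $+$ if and only if the step starts with $\tau$ on its right. Let $\alpha$ be a one-sided closed curve in general position with respect to $T$ and without backtracking: it never leaves a triangle through the side through which it has just entered. (Such a curve is not contractible; every non-contractible one-sided closed curve can be put in this position by a homotopy.) From a base point off $T$ it crosses the arcs $\tau_{i_1},\dots,\tau_{i_d}$, in this order. An *M-path* of $\alpha$ is a closed path $\rho=\rho_t\circ\dots\circ\rho_1$ of elementary steps that crosses the same arcs, between the same triangles and in the same cyclic order; $M(\rho)=M(\rho_t)\cdots M(\rho_1)$ and $\chi_{\alpha,\mathcal L_T}=|\operatorname{tr}M(\rho)|$. *Band graph.* Fix an orientation of the initial triangle and carry it along $\alpha$ (this is the choice of a lift of the base point to the orientable double cover). Tile $G_j$ is a square with diagonal $\tau_{i_j}$ from the northwest to the southeast; its lower left half is the triangle that $\alpha$ leaves at the $j$-th crossing and its upper right half is the one it enters, drawn with the carried orientation if $j$ is odd and with the opposite one if $j$ is even. $G_{j+1}$ is glued to the north or east edge of $G_j$ labelled by the third side of the triangle between the two crossings. This gives a snake graph. The band graph $\widetilde{\mathcal G}_{T,\alpha}$ is obtained by identifying the edge of $G_1$ labelled by the third side $a$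 of the initial triangle with the edge of $G_d$ along which a tile $G_{d+1}$ (a copy of $G_1$) would be glued. A *good matching* $P$ is a perfect matching of the band graph that lifts to a perfect matching $\widehat P$ of the snake graph when one copy of the glued edge is added; $x(P)$ is the product of the labels $x_\tau$ of the edges of $P$. The unique path from the southwest vertex of $G_1$ to the northeast vertex of $G_d$ that alternates between edges of $\widehat P$ and diagonals orients the diagonals, and $y_{\mathcal L_T}(P)$ is the product of $y_{\tau_{i_j}}$ over the $j$ such that, with $b=b_T(L_{\tau_{i_j}},\tau_{i_j})$ for the carried orientation, either $j$ is odd and ($b=1$ and the diagonal is oriented down, or $b=-1$ and it is oriented up), or $j$ is even and ($b=1$ and it is oriented up, or $b=-1$ and it is oriented down). Put $\mathrm{cross}_T(\alpha)=x_{\tau_{i_1}}\cdots x_{\tau_{i_d}}$. **Theorem.** For every such one-sided closed curve $\alpha$, M-paths of $\alpha$ exist, and for every M-path $\rho$ of $\alpha$ (and all choices of local orientations at the marked points, of the base point and of the initial orientation) $$\chi_{\alpha,\mathcal L_T}=|\operatorname{tr}M(\rho)|=\frac1{\mathrm{cross}_T(\alpha)}\sum_P x(P)\,y_{\mathcal L_T}(P),$$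 where the sum is over all good matchings $P$ of the band graph $\widetilde{\mathcal G}_{T,\alpha}$. -/

import Mathlib

/-! # Triangulated marked surfaces, presented as glued triangles -/

/-- A triangulated compact surface with marked points, as a finite collection of triangles with
sides glued in pairs.  Each triangle has corners `0, 1, 2`, listed clockwise for a *reference
orientation* of that triangle (no compatibility between different triangles is assumed); side `i` is
opposite to corner `i`.  `opp` sends a side to the side glued to it; its fixed points are the sides
that are not glued, i.e. the boundary arcs.  `twist s` is `1` if the reference orientations of the two
triangles agree across the side `s`, and `-1` if they disagree. -/
structure TriangleGluing where
  Tri : Type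
  [fintypeTri : Fintype Tri]
  [decEqTri : DecidableEq Tri]
  opp : Tri × ZMod 3 → Tri × ZMod 3
  opp_opp : ∀ s, opp (opp s) = s
  twist : Tri × ZMod 3 → ℤˣ
  twist_opp : ∀ s, twist (opp s) = twist s

namespace TriangleGluing

attribute [instance] TriangleGluing.fintypeTri TriangleGluing.decEqTri

/-- The sides of the triangles: `(Δ, i)` is side `i` of `Δ`. -/
abbrev Side (S : TriangleGluing) : Type := S.Tri × ZMod 3

/-- The side lies on the boundary of the surface. -/
def IsBoundary (S : TriangleGluing) (s : S.Side) : Prop := S.opp s = s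

/-- The arcs of the triangulation together with the boundary arcs: sides, up to gluing. -/
def Edge (S : TriangleGluing) : Type := Quot fun s t : S.Side => t = S.opp s

/-- The arc (or boundary arc) on which a side lies. -/
def edge (S : TriangleGluing) (s : S.Side) : S.Edge := Quot.mk _ s

/-- A sign, as an element of `ZMod 3`. -/
def shift (ε : ℤˣ) : ZMod 3 := ((ε : ℤ) : ZMod 3)

/-! ## The topological surface -/

/-- Gluing of points of sides: along a glued side `s = (Δ, i)` with `S.opp s = (Δ', j)`, the corner
`i + 1` is glued to `j - 1` and `i - 1` to `j + 1` if the reference orientations agree, and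
`i + 1` to `j + 1`, `i - 1` to `j - 1` otherwise (in barycentric coordinates). -/
def GlueRel (S : TriangleGluing) (p q : Σ _ : S.Tri, stdSimplex ℝ (ZMod 3)) : Prop :=
  ∃ s : S.Side, ¬ S.IsBoundary s ∧ p.1 = s.1 ∧ q.1 = (S.opp s).1 ∧
    p.2.1 s.2 = 0 ∧ q.2.1 (S.opp s).2 = 0 ∧
    ∀ ε : ℤˣ, q.2.1 ((S.opp s).2 - shift (S.twist s * ε)) = p.2.1 (s.2 + shift ε)

/-- The surface obtained from the closed triangles by the gluing. -/
def Carrier (S : TriangleGluing) : Type := Quot S.GlueRel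

instance (S : TriangleGluing) : TopologicalSpace S.Carrier :=
  inferInstanceAs (TopologicalSpace (Quot S.GlueRel))

/-- The point of the surface given by a point of a triangle. -/
def point (S : TriangleGluing) (Δ : S.Tri) (p : stdSimplex ℝ (ZMod 3)) : S.Carrier :=
  Quot.mk _ ⟨Δ, p⟩

/-- The corners of the triangles, as points of the surface. -/
def vertices (S : TriangleGluing) : Set S.Carrier := {z | ∃ Δ p i, p.1 i = 1 ∧ z = S.point Δ p}

/-! ## Points near the marked points

A flag `((Δ, i), ε)` is the point inside `Δ`, near side `τ = (Δ, i)`, on the horocycle around the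
marked point `m` at corner `i + ε` of `Δ`.  For the reference orientation of `Δ` it lies clockwise from
`τ` around `m` if `ε = 1` and counterclockwise if `ε = -1`. -/

/-- Points of the form `v^±_{m,τ}`, inside a given triangle. -/
abbrev Flag (S : TriangleGluing) : Type := S.Side × ℤˣ

/-- Go along the horocycle, inside the triangle, from one side at the corner to the other one. -/
def turn (S : TriangleGluing) (f : S.Flag) : S.Flag := ((f.1.1, f.1.2 - shift f.2), -f.2)

/-- Cross the side, along the horocycle. -/
def cross (S : TriangleGluing) (f : S.Flag) : S.Flag := (S.opp f.1, -(S.twist f.1 * f.2))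

/-- Go parallel to the side, inside the triangle, to the other end of the side. -/
def slide (S : TriangleGluing) (f : S.Flag) : S.Flag := (f.1, -f.2)

/-- The side opposite to the corner of a flag. -/
def oppositeSide (S : TriangleGluing) (f : S.Flag) : S.Side := (f.1.1, f.1.2 + shift f.2)

/-- A choice of a local orientation of the surface at every marked point, i.e. a choice of what
clockwise means on every horocycle.  `sign f` compares it, at the marked point of `f`, with the
reference orientation of the triangle of `f`. -/
structure LocalOrientation (S : TriangleGluing) where
  sign : S.Flag → ℤˣ
  sign_turn : ∀ f, sign (S.turn f) = sign f
  sign_cross : ∀ f, ¬ S.IsBoundary f.1 → sign (S.cross f) = S.twist f.1 * sign f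

/-! ## Laminations and shear coordinates

A curve with both ends on the boundary is recorded by the list of the sides it crosses: a boundary
side through which it enters, then each side through which it leaves a triangle, the last one being
a boundary side. -/

/-- The arcs crossed by a curve that starts at a flag, goes around the marked point of the flag,
away from the side of the flag, and ends as soon as it meets the boundary. -/
inductive Fan (S : TriangleGluing) : S.Flag → List S.Side → Prop
  | last (f : S.Flag) : S.IsBoundary (S.turn f).1 → Fan S f [(S.turn f).1]
  | step (f : S.Flag) (l : List S.Side) : ¬ S.IsBoundary (S.turn f).1 →
      Fan S (S.cross (S.turn f)) l → Fan S f ((S.turn f).1 :: l)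

/-- The curve `l` runs along the arc on which `s` lies, crossing it once, from the triangle
of `s` to the other one; at both ends it turns around the endpoint of the arc, in the same direction
(clockwise at both ends or counterclockwise at both ends, for an orientation along the arc, according
to `ε`), until it ends on the boundary. -/
def IsElementaryLamination (S : TriangleGluing) (s : S.Side) (l : List S.Side) : Prop :=
  ∃ (ε : ℤˣ) (l₁ l₂ : List S.Side), S.Fan (s, ε) l₁ ∧ S.Fan (S.cross (S.slide (s, ε))) l₂ ∧
    l = (l₁.map S.opp).reverse ++ s :: l₂

/-- A principal lamination: for every arc `τ` of the triangulation a lamination `L_τ` running along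
`τ` and turning, clockwise or counterclockwise, at its endpoints. -/
structure PrincipalLamination (S : TriangleGluing) where
  curve : S.Edge → List S.Side
  isElementary : ∀ s, ¬ S.IsBoundary s →
    S.IsElementaryLamination s (curve (S.edge s)) ∨
      S.IsElementaryLamination (S.opp s) (curve (S.edge s))

/-- Entering the triangle of `s` through the side glued to `a`, crossing `s`, and then leaving the next
triangle through `c` is an S-intersection with the quadrilateral around `s`, where `o` is an
orientation of the triangle of `s` (relative to its reference orientation), extended across `s`.
That is: the curve turns right and then left, so that it meets opposite sides of the quadrilateral. -/
def IsSIntersection (S : TriangleGluing) (o : ℤˣ) (a s c : S.Side) : Prop :=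
  s.2 = (S.opp a).2 - shift o ∧ c.2 = (S.opp s).2 + shift (o * S.twist s)

/-- The same for Z-intersections: the curve turns left and then right. -/
def IsZIntersection (S : TriangleGluing) (o : ℤˣ) (a s c : S.Side) : Prop :=
  s.2 = (S.opp a).2 + shift o ∧ c.2 = (S.opp s).2 - shift (o * S.twist s)

open Classical in
/-- The number of times that three consecutive entries of the list, the middle one being `s`,
satisfy `R`. -/
noncomputable def countTriples (S : TriangleGluing) (R : S.Side → S.Side → S.Side → Prop)
    (s : S.Side) (l : List S.Side) : ℕ :=
  ((Finset.range l.length).filter fun k =>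
    ∃ a c, l[k]? = some a ∧ l[k + 1]? = some s ∧ l[k + 2]? = some c ∧ R a s c).card

/-- The shear coordinate `b_T(l, τ)` for the arc `τ` on which `s` lies: the number of
S-intersections minus the number of Z-intersections of `l` with the quadrilateral around `τ`, for the
orientation `o` of that quadrilateral (given on the triangle of `s`).  The curve may cross `τ` in
either direction. -/
noncomputable def shear (S : TriangleGluing) (l : List S.Side) (s : S.Side) (o : ℤˣ) : ℤ :=
  ((S.countTriples (S.IsSIntersection o) s l
      + S.countTriples (S.IsSIntersection (o * S.twist s)) (S.opp s) l : ℕ) : ℤ)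
    - ((S.countTriples (S.IsZIntersection o) s l
      + S.countTriples (S.IsZIntersection (o * S.twist s)) (S.opp s) l : ℕ) : ℤ)

/-- `b_T(L_τ, τ)` for the arc `τ` on which `s` lies and the orientation `o` of the triangle of `s`. -/
noncomputable def PrincipalLamination.b {S : TriangleGluing} (L : S.PrincipalLamination)
    (s : S.Side) (o : ℤˣ) : ℤ :=
  S.shear (L.curve (S.edge s)) s o

/-! ## Closed curves -/

/-- The cyclic sequence of crossings of a closed curve, read from a base point that lies off the
triangulation.  The `k`-th crossing leaves the triangle of `side k` through `side k` and
enters the triangle of `S.opp (side k)`.  The curve never leaves a triangle through the side through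
which it has entered it (it has no bigon with the triangulation). -/
structure CrossingSequence (S : TriangleGluing) where
  len : ℕ
  len_pos : 0 < len
  side : ℕ → S.Side
  periodic : ∀ k, side (k + len) = side k
  interior : ∀ k, ¬ S.IsBoundary (side k)
  next : ∀ k, (side (k + 1)).1 = (S.opp (side k)).1
  reduced : ∀ k, side (k + 1) ≠ S.opp (side k)

/-- The closed curve reverses the orientation. -/
def CrossingSequence.IsOneSided {S : TriangleGluing} (w : S.CrossingSequence) : Prop :=
  ∏ k ∈ Finset.range w.len, S.twist (w.side k) = -1

/-- The crossing monomial. -/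
def CrossingSequence.crossingMonomial {S : TriangleGluing} {K : Type*} [Field K]
    (w : S.CrossingSequence) (x : S.Edge → K) : K :=
  ∏ k ∈ Finset.range w.len, x (S.edge (w.side k))

/-! ## M-paths -/

/-- Elementary steps: of type 1 (`turn`), of type 2 (`cross`), and of type 3 or its variant through a
crosscap (`slide`). -/
inductive Step
  | turn
  | cross
  | slide

/-- The flag at which a step ends. -/
def Step.target {S : TriangleGluing} : Step → S.Flag → S.Flag
  | .turn, f => S.turn f
  | .cross, f => S.cross f
  | .slide, f => S.slide f

/-- The matrix of an elementary step that starts at the flag `f`.  With respect to the local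
orientation `o` at the marked point of `f`, the flag lies clockwise from its arc if `σ = 1` (it is
of the form `v^+`) and counterclockwise if `σ = -1` (it is of the form `v^-`).  Hence `turn` is
clockwise iff `σ = 1`, `cross` is clockwise iff `σ = -1`, and `slide` sees the arc on the right
iff `σ = -1`.  A `slide` is of type 3 if the local orientations at the two ends agree along the
arc (it goes from `v^±` to `v^∓`), and goes through a crosscap if they do not (it goes from `v^±`
to `v^±`). -/
noncomputable def Step.matrix {S : TriangleGluing} {K : Type*} [Field K]
    (L : S.PrincipalLamination) (x y : S.Edge → K) (o : S.LocalOrientation) (f : S.Flag) :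
    Step → Matrix (Fin 2) (Fin 2) K
  | .turn =>
      let σ : K := (((f.2 * o.sign f : ℤˣ) : ℤ) : K)
      !![1, 0;
         σ * (x (S.edge (S.oppositeSide f))
            / (x (S.edge f.1) * x (S.edge (S.turn f).1))), 1]
  | .cross =>
      let b := L.b f.1 (o.sign f)
      let yMinus := y (S.edge f.1) ^ (if b = -1 then 1 else 0)
      let yPlus := y (S.edge f.1) ^ (if b = 1 then 1 else 0)
      if f.2 * o.sign f = -1 then !![yMinus, 0; 0, yPlus] else !![yPlus, 0; 0, yMinus]
  | .slide =>
      let σ : K := (((f.2 * o.sign f : ℤˣ) : ℤ) : K)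
      let X := x (S.edge f.1)
      if o.sign (S.slide f) = o.sign f then !![0, -σ * X; σ * (1 / X), 0]
      else !![0, -σ * X; -σ * (1 / X), 0]

/-- A path made of elementary steps. -/
structure StepPath (S : TriangleGluing) where
  start : S.Flag
  steps : List Step

/-- The flag at which the path ends. -/
def endFlag (S : TriangleGluing) : S.Flag → List Step → S.Flag
  | f, [] => f
  | f, m :: l => S.endFlag (m.target f) l

/-- The sides crossed by the path, in order. -/
def crossedSides (S : TriangleGluing) : S.Flag → List Step → List S.Side
  | _, [] => []
  | f, .cross :: l => f.1 :: S.crossedSides (Step.cross.target f) l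
  | f, .turn :: l => S.crossedSides (Step.turn.target f) l
  | f, .slide :: l => S.crossedSides (Step.slide.target f) l

/-- `M(ρ) = M(ρ_t) ⋯ M(ρ_2) M(ρ_1)` for the path `ρ_1, …, ρ_t` starting at the given flag. -/
noncomputable def pathMatrix {S : TriangleGluing} {K : Type*} [Field K]
    (L : S.PrincipalLamination) (x y : S.Edge → K) (o : S.LocalOrientation) :
    S.Flag → List Step → Matrix (Fin 2) (Fin 2) K
  | _, [] => 1
  | f, m :: l => pathMatrix L x y o (m.target f) l * m.matrix L x y o f

/-- The matrix of a path of elementary steps. -/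
noncomputable def StepPath.matrix {S : TriangleGluing} {K : Type*} [Field K]
    (L : S.PrincipalLamination) (x y : S.Edge → K) (o : S.LocalOrientation) (ρ : S.StepPath) :
    Matrix (Fin 2) (Fin 2) K :=
  pathMatrix L x y o ρ.start ρ.steps

/-- `ρ` is an M-path of the closed curve with crossing sequence `w`: it is closed, and crosses the
same arcs as the curve, between the same triangles and in the same cyclic order (as triangles are
simply connected, this says that `ρ` is homotopic to the curve through a homotopy that matches the
intersections with the triangulation). -/
def StepPath.IsMPath {S : TriangleGluing} (ρ : S.StepPath) (w : S.CrossingSequence) : Prop :=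
  S.endFlag ρ.start ρ.steps = ρ.start ∧
    (S.crossedSides ρ.start ρ.steps).IsRotated ((List.range w.len).map w.side)

/-! ## The band graph -/

namespace CrossingSequence

variable {S : TriangleGluing} (w : S.CrossingSequence) (o₀ : ℤˣ)

/-- The orientation `o₀` of the initial triangle carried along the curve: `w.orient o₀ k` is the
resulting orientation of the triangle of `w.side k`, relative to its reference orientation.  (Choosing
`o₀` is choosing one of the two lifts of the base point to the orientable double cover.) -/
def orient : ℕ → ℤˣ
  | 0 => o₀
  | k + 1 => orient k * S.twist (w.side k)

/-- Orientation of the lower left triangle of tile `k` in the plane (tiles are numbered from `0`, and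
are embedded alternatingly with the carried orientation and with its opposite). -/
def orientSW (k : ℕ) : ℤˣ := (-1) ^ k * w.orient o₀ k

/-- Orientation of the upper right triangle of tile `k` in the plane. -/
def orientNE (k : ℕ) : ℤˣ := (-1) ^ k * w.orient o₀ (k + 1)

/-- Tile `k` has the `k`-th crossed arc as diagonal, from the northwest to the southeast.  Its lower
left triangle is the triangle before the crossing: clockwise, its sides are west, diagonal, south. -/
def southSide (k : ℕ) : S.Side := ((w.side k).1, (w.side k).2 + shift (w.orientSW o₀ k))

/-- See `southSide`. -/
def westSide (k : ℕ) : S.Side := ((w.side k).1, (w.side k).2 - shift (w.orientSW o₀ k))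

/-- The upper right triangle of tile `k` is the triangle after the crossing: clockwise, its sides
are north, east, diagonal. -/
def northSide (k : ℕ) : S.Side :=
  ((S.opp (w.side k)).1, (S.opp (w.side k)).2 + shift (w.orientNE o₀ k))

/-- See `northSide`. -/
def eastSide (k : ℕ) : S.Side :=
  ((S.opp (w.side k)).1, (S.opp (w.side k)).2 - shift (w.orientNE o₀ k))

/-- Tile `k + 1` is glued to tile `k` along the third side of the triangle that lies between the two
crossings: it is east of tile `k` if the next crossed side is the north one, and north otherwise. -/
def GlueEast (k : ℕ) : Prop := w.side (k + 1) = w.northSide o₀ k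

open Classical in
/-- The southwest corner of tile `k`. -/
noncomputable def tilePos : ℕ → ℤ × ℤ
  | 0 => (0, 0)
  | k + 1 => if w.GlueEast o₀ k then tilePos k + (1, 0) else tilePos k + (0, 1)

/-- The corners of tile `k`. -/
noncomputable def cornerSW (k : ℕ) : ℤ × ℤ := w.tilePos o₀ k

/-- See `cornerSW`. -/
noncomputable def cornerSE (k : ℕ) : ℤ × ℤ := w.tilePos o₀ k + (1, 0)

/-- See `cornerSW`. -/
noncomputable def cornerNW (k : ℕ) : ℤ × ℤ := w.tilePos o₀ k + (0, 1)

/-- See `cornerSW`. -/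
noncomputable def cornerNE (k : ℕ) : ℤ × ℤ := w.tilePos o₀ k + (1, 1)

/-- The edges of tile `k`: a segment in the plane with the arc labelling it. -/
noncomputable def southEdge (k : ℕ) : Sym2 (ℤ × ℤ) × S.Edge :=
  (s(w.cornerSW o₀ k, w.cornerSE o₀ k), S.edge (w.southSide o₀ k))

/-- See `southEdge`. -/
noncomputable def westEdge (k : ℕ) : Sym2 (ℤ × ℤ) × S.Edge :=
  (s(w.cornerSW o₀ k, w.cornerNW o₀ k), S.edge (w.westSide o₀ k))

/-- See `southEdge`. -/
noncomputable def northEdge (k : ℕ) : Sym2 (ℤ × ℤ) × S.Edge :=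
  (s(w.cornerNW o₀ k, w.cornerNE o₀ k), S.edge (w.northSide o₀ k))

/-- See `southEdge`. -/
noncomputable def eastEdge (k : ℕ) : Sym2 (ℤ × ℤ) × S.Edge :=
  (s(w.cornerSE o₀ k, w.cornerNE o₀ k), S.edge (w.eastSide o₀ k))

open Classical in
/-- The labelled edges of the snake graph of the curve cut open at the base point: the union of its
tiles, where consecutive tiles share an edge. -/
noncomputable def snakeEdges : Finset (Sym2 (ℤ × ℤ) × S.Edge) :=
  (Finset.range w.len).biUnion fun k =>
    {w.southEdge o₀ k, w.westEdge o₀ k, w.northEdge o₀ k, w.eastEdge o₀ k}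

/-- The vertices of the snake graph. -/
def IsSnakeVertex (v : ℤ × ℤ) : Prop := ∃ e ∈ w.snakeEdges o₀, v ∈ e.1

open Classical in
/-- The edge of the first tile that is glued in the band graph: it is labelled by the third side of
the initial triangle (the one that is neither the first nor the last crossed side). -/
noncomputable def firstGluedEdge : Sym2 (ℤ × ℤ) × S.Edge :=
  if S.opp (w.side (w.len - 1)) = w.southSide o₀ 0 then w.westEdge o₀ 0 else w.southEdge o₀ 0

open Classical in
/-- The edge of the last tile that is glued in the band graph: the one along which the next tile of
the infinite snake graph would be glued. -/
noncomputable def lastGluedEdge : Sym2 (ℤ × ℤ) × S.Edge :=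
  if w.GlueEast o₀ (w.len - 1) then w.eastEdge o₀ (w.len - 1) else w.northEdge o₀ (w.len - 1)

/-- Perfect matchings of the snake graph. -/
def IsPerfectMatching (P : Finset (Sym2 (ℤ × ℤ) × S.Edge)) : Prop :=
  P ⊆ w.snakeEdges o₀ ∧ ∀ v, w.IsSnakeVertex o₀ v → ∃! e, e ∈ P ∧ v ∈ e.1

open Classical in
/-- The good matchings of the band graph (the snake graph with its first and last glued edges
identified).  A good matching is a perfect matching of the band graph in which the ends of the glued
edge are matched by edges of the first tile or else by edges of the last tile; it is represented here by
the perfect matching of the snake graph to which it lifts when one copy of the glued edge is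
added.  So these are the perfect matchings of the snake graph that contain at least one of the two
copies of the glued edge. -/
noncomputable def goodMatchings : Finset (Finset (Sym2 (ℤ × ℤ) × S.Edge)) :=
  (w.snakeEdges o₀).powerset.filter fun P =>
    w.IsPerfectMatching o₀ P ∧ (w.firstGluedEdge o₀ ∈ P ∨ w.lastGluedEdge o₀ ∈ P)

/-- The weight `x(P)` of a good matching: the product of the labels of its edges in the band graph,
that is, of all edges of its lift `P` except for one copy of the glued edge. -/
noncomputable def weight {K : Type*} [Field K] (x : S.Edge → K)
    (P : Finset (Sym2 (ℤ × ℤ) × S.Edge)) : K :=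
  (∏ e ∈ P, x e.2) / x (w.firstGluedEdge o₀).2

/-- The path, through the vertices `v 0, v 1, …, v (2 * len + 1)`, from the southwest corner of the first
tile to the northeast corner of the last tile that takes alternatingly edges of `P` and
the diagonals of the tiles. -/
def IsAlternatingPath (P : Finset (Sym2 (ℤ × ℤ) × S.Edge)) (v : ℕ → ℤ × ℤ) : Prop :=
  v 0 = w.cornerSW o₀ 0 ∧ v (2 * w.len + 1) = w.cornerNE o₀ (w.len - 1) ∧
    (∀ k ≤ w.len, ∃ e ∈ P, e.1 = s(v (2 * k), v (2 * k + 1))) ∧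
    ∀ k < w.len, s(v (2 * k + 1), v (2 * k + 2)) = s(w.cornerNW o₀ k, w.cornerSE o₀ k)

/-- The diagonal of tile `k` is oriented down by `P`: it is traversed from northwest to southeast. -/
def DiagonalDown (P : Finset (Sym2 (ℤ × ℤ) × S.Edge)) (k : ℕ) : Prop :=
  ∃ v, w.IsAlternatingPath o₀ P v ∧ v (2 * k + 1) = w.cornerNW o₀ k

/-- The diagonal of tile `k` is oriented up by `P`: it is traversed from southeast to northwest. -/
def DiagonalUp (P : Finset (Sym2 (ℤ × ℤ) × S.Edge)) (k : ℕ) : Prop :=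
  ∃ v, w.IsAlternatingPath o₀ P v ∧ v (2 * k + 1) = w.cornerSE o₀ k

/-- The diagonal of tile `k` is oriented according to the principal lamination.  Tiles are numbered
from `0` here, so that `Even k` are the tiles of odd index when they are numbered from `1`. -/
def IsLaminationOriented (L : S.PrincipalLamination) (P : Finset (Sym2 (ℤ × ℤ) × S.Edge)) (k : ℕ) :
    Prop :=
  let b := L.b (w.side k) (w.orient o₀ k)
  (Even k ∧ (b = 1 ∧ w.DiagonalDown o₀ P k ∨ b = -1 ∧ w.DiagonalUp o₀ P k)) ∨
    (Odd k ∧ (b = 1 ∧ w.DiagonalUp o₀ P k ∨ b = -1 ∧ w.DiagonalDown o₀ P k))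

open Classical in
/-- The coefficient monomial of a good matching. -/
noncomputable def coefficientMonomial {K : Type*} [Field K] (L : S.PrincipalLamination)
    (y : S.Edge → K) (P : Finset (Sym2 (ℤ × ℤ) × S.Edge)) : K :=
  ∏ k ∈ (Finset.range w.len).filter (w.IsLaminationOriented o₀ L P), y (S.edge (w.side k))

/-- The good matching enumerator of the band graph. -/
noncomputable def goodMatchingEnumerator {K : Type*} [Field K] (L : S.PrincipalLamination)
    (x y : S.Edge → K) : K :=
  ∑ P ∈ w.goodMatchings o₀, w.weight o₀ x P * w.coefficientMonomial o₀ L y P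

end CrossingSequence

end TriangleGluing

/-! ## Triangulations of marked surfaces and their closed curves -/

/-- A triangulation of the marked surface `(X, M)`: a presentation of `X` as glued triangles, with
`M` as the set of corners. -/
structure SurfaceTriangulation (X : Type*) [TopologicalSpace X] (M : Set X) where
  gluing : TriangleGluing
  homeo : gluing.Carrier ≃ₜ X
  image_vertices : homeo '' gluing.vertices = M

/-- The point of a triangle lies in the relative interior of side `i`. -/
def OnOpenSide (i : ZMod 3) (p : stdSimplex ℝ (ZMod 3)) : Prop :=
  p.1 i = 0 ∧ ∀ j, j ≠ i → 0 < p.1 j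

/-- The closed curve `α` is in general position with respect to the triangulation, with crossing
sequence `w`: it is a concatenation of curves (given by `c (k + 1)` on the time interval from `t k` to
`t (k + 1)`) which run in the interiors of the triangles, each from the open side
`opp (w.side k)` to the open side `w.side (k + 1)`. -/
def SurfaceTriangulation.HasCrossingSequence {X : Type*} [TopologicalSpace X] {M : Set X}
    (T : SurfaceTriangulation X M) (α : C(AddCircle (1 : ℝ), X)) (w : T.gluing.CrossingSequence) :
    Prop :=
  ∃ (t : ℕ → ℝ) (c : ℕ → ℝ → stdSimplex ℝ (ZMod 3)), t w.len = t 0 + 1 ∧ ∀ k < w.len,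
    t k < t (k + 1) ∧
    ContinuousOn (c (k + 1)) (Set.Icc (t k) (t (k + 1))) ∧
    (∀ u ∈ Set.Icc (t k) (t (k + 1)),
      α (u : AddCircle (1 : ℝ)) = T.homeo (T.gluing.point (w.side (k + 1)).1 (c (k + 1) u))) ∧
    (∀ u ∈ Set.Ioo (t k) (t (k + 1)), ∀ i, 0 < (c (k + 1) u).1 i) ∧
    OnOpenSide (T.gluing.opp (w.side k)).2 (c (k + 1) (t k)) ∧
    OnOpenSide (w.side (k + 1)).2 (c (k + 1) (t (k + 1)))

namespace TriangleGluing

variable {S : TriangleGluing} {K : Type*} [Field K]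

/-! ## Signs -/

/-! Inside a triangle, the matrix of an M-path is a change of basis up to sign. Give the corners of
a triangle with labels X three plane vectors v_i with det(v_i, v_{i+1}) = X_{i+2}, hence Σ X_i v_i =
0. The vectors at the two ends of a side, one of them rescaled, form a basis of determinant 1
(`frame`). Steps inside a triangle carry these bases to one another up to sign (`frame_turn`,
`frame_slide`), and crossing a side is, up to sign, the same linear map at both of its ends
(`frame_cross`). So the trace of a closed path is, up to sign, that of a product depending only on
the crossed sides (`trace_refPathMatrix`), and rotating the sequence does not change it. Local
orientations only conjugate by diag(1, ±1) (`trace_pathMatrix`). It therefore suffices to compute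
one M-path.

The standard path visits the northwest end of each diagonal. After a rescaling of coordinates, its
piece from one tile to the next is, up to sign and the factor 1/x of the crossed arc, a nonnegative
matrix: its entries are the labels of the snake graph edges joining the ends of consecutive
diagonals, multiplied by powers of y (`scaling_mul_refPathMatrix_blockSteps`). As the curve is
one-sided, the tile after the last one is a copy of the first tile, reflected exactly when the
number d of tiles is even. In that case a final slide is needed, which swaps the two coordinates.
The trace is thus Σ_i Q(σ i, i), with Q the product of the transfer matrices and σ the swap or the
identity (`IsOneSided.trace_standardPath`).

Every edge of the snake graph joins neighbouring antidiagonals, and a perfect matching has exactly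
one edge between each two of them. It is therefore a sequence of ends of diagonals, namely those at
which the alternating path arrives (`IsPerfectMatching.exists_eq_matchingOf`). Such sequences also
index the expansion of the matrix product, and the nonzero terms of the twisted trace are the good
matchings with their weights (`IsOneSided.goodMatchingEnumerator_eq`). All terms are nonnegative, so
the absolute value removes the remaining sign. -/

theorem shift_neg (ε : ℤˣ) : shift (-ε) = -shift ε := by
  simp [shift]

theorem shift_eq_one_or_neg_one (ε : ℤˣ) : shift ε = 1 ∨ shift ε = -1 := by
  rcases Int.units_eq_one_or ε with rfl | rfl <;> simp [shift]

theorem sub_shift_sub_shift (i : ZMod 3) (ε : ℤˣ) : i - shift ε - shift ε = i + shift ε := by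
  rcases shift_eq_one_or_neg_one ε with h | h <;> rw [h] <;> revert i <;> decide

theorem add_shift_add_shift (i : ZMod 3) (ε : ℤˣ) : i + shift ε + shift ε = i - shift ε := by
  rcases shift_eq_one_or_neg_one ε with h | h <;> rw [h] <;> revert i <;> decide

theorem eq_or_eq_add_shift_or_eq_sub_shift (i j : ZMod 3) (ε : ℤˣ) :
    j = i ∨ j = i + shift ε ∨ j = i - shift ε := by
  rcases shift_eq_one_or_neg_one ε with h | h <;> rw [h] <;> revert i j <;> decide

/-- The sign `u` acting on the second coordinate. -/
def signMatrix (K : Type*) [Field K] (u : ℤˣ) : Matrix (Fin 2) (Fin 2) K :=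
  !![1, 0; 0, ((u : ℤ) : K)]

theorem signMatrix_mul_self (u : ℤˣ) : signMatrix K u * signMatrix K u = 1 := by
  rcases Int.units_eq_one_or u with rfl | rfl <;>
    simp [signMatrix, Matrix.one_fin_two]

theorem edge_opp (s : S.Side) : S.edge (S.opp s) = S.edge s :=
  (Quot.sound (r := fun s t : S.Side => t = S.opp s) rfl).symm

theorem PrincipalLamination.b_neg (L : S.PrincipalLamination) (s : S.Side) (o : ℤˣ) :
    L.b s (-o) = -L.b s o := by
  have h1 : ∀ o : ℤˣ, S.IsSIntersection (-o) = S.IsZIntersection o := by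
    intro o
    funext a s c
    simp [IsSIntersection, IsZIntersection, shift_neg, sub_eq_add_neg]
  have h2 : ∀ o : ℤˣ, S.IsZIntersection (-o) = S.IsSIntersection o := fun o => by
    rw [← h1, neg_neg]
  simp only [PrincipalLamination.b, shear, neg_mul, h1, h2]
  ring

/-! ## Matrices of elementary steps for the reference orientations -/

/-- The matrix of the crossing of the side `s` along a horocycle, starting at the flag `(s, ε)`. -/
noncomputable def crossMatrix (L : S.PrincipalLamination) (y : S.Edge → K) (s : S.Side) (ε : ℤˣ) :
    Matrix (Fin 2) (Fin 2) K :=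
  !![y (S.edge s) ^ (if L.b s ε = 1 then 1 else 0), 0;
    0, y (S.edge s) ^ (if L.b s ε = -1 then 1 else 0)]

/-- Reversing the local orientation exchanges clockwise and counterclockwise, but also negates the
shear coordinate; the two effects cancel. -/
theorem Step.matrix_cross (L : S.PrincipalLamination) (x y : S.Edge → K) (o : S.LocalOrientation)
    (f : S.Flag) : Step.cross.matrix L x y o f = crossMatrix L y f.1 f.2 := by
  obtain ⟨s, ε⟩ := f
  simp only [Step.matrix, crossMatrix]
  rcases Int.units_eq_one_or ε with rfl | rfl <;>
    rcases Int.units_eq_one_or (o.sign (s, _)) with h | h <;> rw [h] <;>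
    simp [PrincipalLamination.b_neg, neg_eq_iff_eq_neg]

/-- The matrix of an elementary step with respect to the reference orientations of the triangles. -/
noncomputable def Step.refMatrix (L : S.PrincipalLamination) (x y : S.Edge → K) (f : S.Flag) :
    Step → Matrix (Fin 2) (Fin 2) K
  | .turn =>
      !![1, 0;
         ((f.2 : ℤ) : K) * (x (S.edge (S.oppositeSide f))
            / (x (S.edge f.1) * x (S.edge (S.turn f).1))), 1]
  | .cross => signMatrix K (S.twist f.1) * crossMatrix L y f.1 f.2
  | .slide =>
      !![0, -((f.2 : ℤ) : K) * x (S.edge f.1); ((f.2 : ℤ) : K) * (1 / x (S.edge f.1)), 0]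

/-- The matrix of a path with respect to the reference orientations of the triangles. -/
noncomputable def refPathMatrix (L : S.PrincipalLamination) (x y : S.Edge → K) :
    S.Flag → List Step → Matrix (Fin 2) (Fin 2) K
  | _, [] => 1
  | f, m :: l => refPathMatrix L x y (m.target f) l * m.refMatrix L x y f

/-- A change of local orientation at a marked point acts as the change of coordinates diag(1, ±1)
there. The twist in `refMatrix` accounts for the two triangles at a crossed side having different
reference orientations. -/
theorem Step.matrix_eq (L : S.PrincipalLamination) (x y : S.Edge → K) (o : S.LocalOrientation)
    (f : S.Flag) (m : Step) (h : m = .cross → ¬ S.IsBoundary f.1) :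
    m.matrix L x y o f = signMatrix K (o.sign (m.target f)) * m.refMatrix L x y f *
      signMatrix K (o.sign f) := by
  cases m with
  | turn =>
    simp only [Step.matrix, Step.target, Step.refMatrix, o.sign_turn]
    rcases Int.units_eq_one_or (o.sign f) with h | h <;> rw [h] <;>
      simp [signMatrix]
  | cross =>
    simp only [Step.matrix_cross, Step.target, Step.refMatrix, o.sign_cross f (h rfl), crossMatrix]
    rcases Int.units_eq_one_or (o.sign f) with h | h <;>
      rcases Int.units_eq_one_or (S.twist f.1) with h' | h' <;> rw [h, h'] <;>
      split_ifs <;> simp [signMatrix]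
  | slide =>
    simp only [Step.matrix, Step.target, Step.refMatrix]
    rcases Int.units_eq_one_or (o.sign f) with h | h <;>
      rcases Int.units_eq_one_or (o.sign (S.slide f)) with h' | h' <;> rw [h, h'] <;>
      simp [signMatrix]

theorem pathMatrix_eq (L : S.PrincipalLamination) (x y : S.Edge → K) (o : S.LocalOrientation)
    (l : List Step) (f : S.Flag) (h : ∀ s ∈ S.crossedSides f l, ¬ S.IsBoundary s) :
    pathMatrix L x y o f l = signMatrix K (o.sign (S.endFlag f l)) * refPathMatrix L x y f l *
      signMatrix K (o.sign f) := by
  induction l generalizing f with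
  | nil => simp [pathMatrix, endFlag, refPathMatrix, signMatrix_mul_self]
  | cons m l ih =>
    have h1 : m = .cross → ¬ S.IsBoundary f.1 := by
      rintro rfl
      exact h _ (by simp [crossedSides])
    have h2 : ∀ s ∈ S.crossedSides (m.target f) l, ¬ S.IsBoundary s := fun s hs =>
      h s (by cases m <;> simp [crossedSides, hs])
    simp only [pathMatrix, endFlag, refPathMatrix, ih _ h2, Step.matrix_eq L x y o f m h1]
    simp only [← Matrix.mul_assoc]
    rw [Matrix.mul_assoc _ (signMatrix K _) (signMatrix K _), signMatrix_mul_self, Matrix.mul_one]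

theorem trace_pathMatrix (L : S.PrincipalLamination) (x y : S.Edge → K) (o : S.LocalOrientation)
    (l : List Step) (f : S.Flag) (h : ∀ s ∈ S.crossedSides f l, ¬ S.IsBoundary s)
    (hf : S.endFlag f l = f) :
    (pathMatrix L x y o f l).trace = (refPathMatrix L x y f l).trace := by
  rw [pathMatrix_eq L x y o l f h, hf, Matrix.trace_mul_comm, ← Matrix.mul_assoc,
    signMatrix_mul_self, Matrix.one_mul]

/-! ## Frames -/

/-- Three vectors in the plane whose pairwise determinants are the labels `X` of a triangle. -/
def cornerVector (X : ZMod 3 → K) (i : ZMod 3) : Fin 2 → K :=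
  if i = 0 then ![1, 0] else if i = 1 then ![0, X 2] else ![-(X 0 / X 2), -X 1]

/-- This is the linear relation between three vectors of a plane, whose coefficients are their
pairwise determinants. -/
theorem cornerVector_relation (X : ZMod 3 → K) (hX : ∀ i, X i ≠ 0) (i : ZMod 3) (ε : ℤˣ)
    (j : Fin 2) :
    X i * cornerVector X i j + X (i + shift ε) * cornerVector X (i + shift ε) j
      + X (i - shift ε) * cornerVector X (i - shift ε) j = 0 := by
  have h0 : ∑ i, X i * cornerVector X i j = 0 := by
    have h2 := hX 2
    rw [show (Finset.univ : Finset (ZMod 3)) = {0, 1, 2} by decide]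
    have h10 : (1 : ZMod 3) ≠ 0 := by decide
    have h20 : (2 : ZMod 3) ≠ 0 := by decide
    have h21 : (2 : ZMod 3) ≠ 1 := by decide
    rw [Finset.sum_insert (by decide), Finset.sum_insert (by decide), Finset.sum_singleton]
    fin_cases j <;> simp [cornerVector, h10, h20, h21] <;> field_simp <;> ring
  have h2 : i ≠ i + shift ε ∧ i ≠ i - shift ε ∧ i + shift ε ≠ i - shift ε := by
    rcases shift_eq_one_or_neg_one ε with h | h <;> rw [h] <;> revert i <;> decide
  have h1 : (Finset.univ : Finset (ZMod 3)) = {i, i + shift ε, i - shift ε} := by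
    ext k
    simpa using eq_or_eq_add_shift_or_eq_sub_shift i k ε
  rw [h1, Finset.sum_insert (by simp [h2.1, h2.2.1]), Finset.sum_insert (by simp [h2.2.2]),
    Finset.sum_singleton, ← add_assoc] at h0
  exact h0

/-- The labels of the sides of a triangle. -/
def label (x : S.Edge → K) (Δ : S.Tri) (i : ZMod 3) : K := x (S.edge (Δ, i))

/-- A basis of the plane attached to a flag. -/
noncomputable def frame (x : S.Edge → K) (f : S.Flag) : Matrix (Fin 2) (Fin 2) K :=
  let X := label x f.1.1
  let p := cornerVector X (f.1.2 - shift f.2)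
  let q := cornerVector X (f.1.2 + shift f.2)
  !![-((f.2 : ℤ) : K) * p 0 / X f.1.2, q 0; -((f.2 : ℤ) : K) * p 1 / X f.1.2, q 1]

theorem det_frame (x : S.Edge → K) (hx : ∀ e, x e ≠ 0) (f : S.Flag) : (frame x f).det = 1 := by
  obtain ⟨⟨Δ, i⟩, ε⟩ := f
  have hX : ∀ i, label x Δ i ≠ 0 := fun i => hx _
  have e1 : (0 : ZMod 3) - 1 = 2 := by decide
  have e2 : (2 : ZMod 3) + 1 = 0 := by decide
  have e3 : (2 : ZMod 3) - 1 = 1 := by decide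
  have e4 : (1 : ZMod 3) + 1 = 2 := by decide
  have e5 : (0 : ZMod 3) + -1 = 2 := by decide
  have e6 : (2 : ZMod 3) + -1 = 1 := by decide
  have h10 : (1 : ZMod 3) ≠ 0 := by decide
  have h20 : (2 : ZMod 3) ≠ 0 := by decide
  have h21 : (2 : ZMod 3) ≠ 1 := by decide
  have := hX 0
  have := hX 1
  have := hX 2
  obtain rfl | rfl | rfl : i = 0 ∨ i = 1 ∨ i = 2 := by revert i; decide
  all_goals
    rcases Int.units_eq_one_or ε with rfl | rfl <;>
      simp only [frame, cornerVector, Matrix.det_fin_two_of, shift, Units.val_one, Units.val_neg,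
        Int.cast_one, Int.cast_neg, sub_neg_eq_add, zero_add, sub_self, add_neg_cancel, e1, e2, e3,
        e4, e5, e6, h10, h20, h21, if_true, if_false, Matrix.cons_val_zero, Matrix.cons_val_one] <;>
      field_simp <;> ring

theorem frame_turn (L : S.PrincipalLamination) (x y : S.Edge → K) (hx : ∀ e, x e ≠ 0)
    (f : S.Flag) : frame x (S.turn f) * Step.turn.refMatrix L x y f = frame x f := by
  obtain ⟨⟨Δ, i⟩, ε⟩ := f
  have hX : ∀ i, label x Δ i ≠ 0 := fun i => hx _
  have r0 := cornerVector_relation (label x Δ) hX i ε 0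
  have r1 := cornerVector_relation (label x Δ) hX i ε 1
  have hi := hX i
  have hj := hX (i - shift ε)
  have e1 : i - shift ε + shift ε = i := by ring
  simp only [frame, turn, Step.refMatrix, oppositeSide, shift_neg, sub_neg_eq_add,
    ← sub_eq_add_neg, sub_shift_sub_shift, e1, Matrix.mul_fin_two, Units.val_neg, Int.cast_neg]
  rw [show x (S.edge (Δ, i)) = label x Δ i from rfl,
    show x (S.edge (Δ, i + shift ε)) = label x Δ (i + shift ε) from rfl,
    show x (S.edge (Δ, i - shift ε)) = label x Δ (i - shift ε) from rfl]
  congr 1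
  ext a b
  fin_cases a <;> fin_cases b <;> simp <;> field_simp
  -- The second columns agree because a turn keeps the marked point. The first columns agree by the
  -- relation Σ X_i v_i = 0.
  · linear_combination ((ε : ℤ) : K) * r0
  · linear_combination ((ε : ℤ) : K) * r1

theorem frame_slide (L : S.PrincipalLamination) (x y : S.Edge → K) (hx : ∀ e, x e ≠ 0)
    (f : S.Flag) : frame x (S.slide f) * Step.slide.refMatrix L x y f = -frame x f := by
  obtain ⟨⟨Δ, i⟩, ε⟩ := f
  have hX : label x Δ i ≠ 0 := hx _
  simp only [frame, slide, Step.refMatrix, shift_neg, sub_neg_eq_add, ← sub_eq_add_neg,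
    Matrix.mul_fin_two, Units.val_neg, Int.cast_neg]
  rw [show x (S.edge (Δ, i)) = label x Δ i from rfl]
  ext a b
  rcases Int.units_eq_one_or ε with rfl | rfl <;> fin_cases a <;> fin_cases b <;> simp <;>
    field_simp

/-- The crossing of a side, in the frames at its two ends. -/
noncomputable def sideMatrix (L : S.PrincipalLamination) (x y : S.Edge → K) (s : S.Side) :
    Matrix (Fin 2) (Fin 2) K :=
  frame x (S.cross (s, 1)) * Step.cross.refMatrix L x y (s, 1) * (frame x (s, 1))⁻¹

theorem cross_slide (f : S.Flag) : S.cross (S.slide f) = S.slide (S.cross f) := by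
  simp [cross, slide]

/-- A slide exchanges the two coordinates, while crossing at the other end exchanges the two
exponents of y because the shear coordinate changes sign. So crossing and sliding commute up to
sign. -/
theorem refMatrix_cross_slide (L : S.PrincipalLamination) (x y : S.Edge → K) (f : S.Flag) :
    Step.cross.refMatrix L x y (S.slide f) * Step.slide.refMatrix L x y f =
      -(Step.slide.refMatrix L x y (S.cross f) * Step.cross.refMatrix L x y f) := by
  obtain ⟨s, ε⟩ := f
  simp only [Step.refMatrix, slide, cross, edge_opp, crossMatrix, PrincipalLamination.b_neg,
    neg_eq_iff_eq_neg, signMatrix, neg_neg]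
  rcases Int.units_eq_one_or ε with rfl | rfl <;>
    rcases Int.units_eq_one_or (S.twist s) with h | h <;> rw [h] <;>
    split_ifs <;> simp [mul_comm]

theorem isUnit_det_frame (x : S.Edge → K) (hx : ∀ e, x e ≠ 0) (f : S.Flag) :
    IsUnit (frame x f).det := by
  rw [det_frame x hx]
  exact isUnit_one

theorem frame_cross (L : S.PrincipalLamination) (x y : S.Edge → K) (hx : ∀ e, x e ≠ 0)
    (f : S.Flag) :
    frame x (S.cross f) * Step.cross.refMatrix L x y f =
      ((f.2 : ℤ) : K) • (sideMatrix L x y f.1 * frame x f) := by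
  obtain ⟨s, ε⟩ := f
  have h1 : frame x (S.cross (s, 1)) * Step.cross.refMatrix L x y (s, 1) =
      sideMatrix L x y s * frame x (s, 1) := by
    rw [sideMatrix, Matrix.mul_assoc, Matrix.nonsing_inv_mul _ (isUnit_det_frame x hx _),
      Matrix.mul_one]
  rcases Int.units_eq_one_or ε with rfl | rfl
  · simpa using h1
  -- The flag `(s, -1)` is the slide of `(s, 1)`. Multiplying by the invertible slide matrix and
  -- exchanging slide and crossing reduces this case to `h1`.
  · change frame x (S.cross (S.slide (s, 1))) * Step.cross.refMatrix L x y (S.slide (s, 1)) =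
      (((-1 : ℤˣ) : ℤ) : K) • (sideMatrix L x y s * frame x (S.slide (s, 1)))
    have hs := frame_slide L x y hx (s, 1)
    have hdet : IsUnit (Step.slide.refMatrix L x y (s, 1)).det := by
      have := hx (S.edge s)
      simp [Step.refMatrix, Matrix.det_fin_two_of, this]
    have hu : IsUnit (Step.slide.refMatrix L x y (s, 1)) := (Matrix.isUnit_iff_isUnit_det _).2 hdet
    apply hu.mul_left_injective
    simp only [Matrix.smul_mul]
    rw [Matrix.mul_assoc, refMatrix_cross_slide, Matrix.mul_assoc _ (frame x _), hs, cross_slide,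
      Matrix.mul_neg, ← Matrix.mul_assoc, frame_slide L x y hx, Matrix.neg_mul, neg_neg, h1,
      Matrix.mul_neg]
    simp

/-- Up to sign, the matrix of a path is determined by its ends and the sides which it crosses. -/
theorem frame_refPathMatrix (L : S.PrincipalLamination) (x y : S.Edge → K) (hx : ∀ e, x e ≠ 0)
    (l : List Step) (f : S.Flag) :
    ∃ u : ℤˣ, frame x (S.endFlag f l) * refPathMatrix L x y f l =
      ((u : ℤ) : K) • (((S.crossedSides f l).map (sideMatrix L x y)).reverse.prod * frame x f) := by
  induction l generalizing f with
  | nil => exact ⟨1, by simp [endFlag, refPathMatrix, crossedSides]⟩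
  | cons m l ih =>
    obtain ⟨u, hu⟩ := ih (m.target f)
    simp only [endFlag, refPathMatrix, ← Matrix.mul_assoc, hu, Matrix.smul_mul]
    cases m with
    | turn => exact ⟨u, by simp [Matrix.mul_assoc, Step.target, frame_turn L x y hx, crossedSides]⟩
    | cross =>
      exact ⟨u * f.2, by
        simp [Matrix.mul_assoc, Step.target, frame_cross L x y hx, crossedSides, smul_smul]⟩
    | slide =>
      exact ⟨-u, by simp [Matrix.mul_assoc, Step.target, frame_slide L x y hx, crossedSides]⟩

/-! ### Traces of closed paths depend only on the cyclic sequence of crossings -/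

theorem trace_refPathMatrix (L : S.PrincipalLamination) (x y : S.Edge → K) (hx : ∀ e, x e ≠ 0)
    (l : List Step) (f : S.Flag) (hf : S.endFlag f l = f) :
    ∃ u : ℤˣ, (refPathMatrix L x y f l).trace =
      ((u : ℤ) : K) * (((S.crossedSides f l).map (sideMatrix L x y)).reverse.prod).trace := by
  obtain ⟨u, hu⟩ := frame_refPathMatrix L x y hx l f
  refine ⟨u, ?_⟩
  rw [hf] at hu
  have h := congrArg (fun M => ((frame x f)⁻¹ * M).trace) hu
  simp only [← Matrix.mul_assoc, Matrix.nonsing_inv_mul _ (isUnit_det_frame x hx f),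
    Matrix.one_mul, Matrix.mul_smul, Matrix.trace_smul, smul_eq_mul] at h
  rw [h, Matrix.trace_mul_comm, ← Matrix.mul_assoc, Matrix.mul_nonsing_inv _
    (isUnit_det_frame x hx f), Matrix.one_mul]

theorem _root_.List.IsRotated.trace_prod_reverse_map {ι : Type*} {l l' : List ι}
    (h : l.IsRotated l') (B : ι → Matrix (Fin 2) (Fin 2) K) :
    ((l.map B).reverse.prod).trace = ((l'.map B).reverse.prod).trace := by
  obtain ⟨n, rfl⟩ := h
  rcases l with _ | ⟨a, l⟩
  · simp
  rw [← List.rotate_mod, List.rotate_eq_drop_append_take (Nat.mod_lt _ (by simp)).le]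
  conv_lhs => rw [← List.take_append_drop (n % (a :: l).length) (a :: l)]
  simp only [List.map_append, List.reverse_append, List.prod_append]
  rw [Matrix.trace_mul_comm]

theorem StepPath.IsMPath.interior {w : S.CrossingSequence} {ρ : S.StepPath} (h : ρ.IsMPath w) :
    ∀ s ∈ S.crossedSides ρ.start ρ.steps, ¬ S.IsBoundary s := by
  intro s hs
  obtain ⟨k, -, rfl⟩ := List.mem_map.1 (h.2.perm.mem_iff.1 hs)
  exact w.interior k

/-- Both traces are, up to sign, the trace of the product of `sideMatrix` over the crossings of `w`.
The second one stays in reference form because that is how the standard path is evaluated. -/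
theorem StepPath.IsMPath.trace_matrix {w : S.CrossingSequence} {ρ ρ' : S.StepPath}
    (h : ρ.IsMPath w) (h' : ρ'.IsMPath w) (L : S.PrincipalLamination) (x y : S.Edge → K)
    (hx : ∀ e, x e ≠ 0) (o : S.LocalOrientation) :
    ∃ u : ℤˣ, (ρ.matrix L x y o).trace =
      ((u : ℤ) : K) * (refPathMatrix L x y ρ'.start ρ'.steps).trace := by
  obtain ⟨u, hu⟩ := trace_refPathMatrix L x y hx ρ.steps ρ.start h.1
  obtain ⟨u', hu'⟩ := trace_refPathMatrix L x y hx ρ'.steps ρ'.start h'.1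
  refine ⟨u * u', ?_⟩
  rw [StepPath.matrix, trace_pathMatrix L x y o _ _ h.interior h.1, hu, hu',
    (h.2.trans h'.2.symm).trace_prod_reverse_map, Units.val_mul, Int.cast_mul]
  have : ((u' : ℤ) : K) * ((u' : ℤ) : K) = 1 := by
    rcases Int.units_eq_one_or u' with rfl | rfl <;> simp
  rw [mul_assoc, ← mul_assoc ((u' : ℤ) : K), this, one_mul]

/-! ### Concatenation of paths -/

theorem refPathMatrix_append (L : S.PrincipalLamination) (x y : S.Edge → K) (l l' : List Step)
    (f : S.Flag) : refPathMatrix L x y f (l ++ l') =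
      refPathMatrix L x y (S.endFlag f l) l' * refPathMatrix L x y f l := by
  induction l generalizing f with
  | nil => simp [endFlag, refPathMatrix]
  | cons m l ih => simp [endFlag, refPathMatrix, ih, Matrix.mul_assoc]

theorem endFlag_append (l l' : List Step) (f : S.Flag) :
    S.endFlag f (l ++ l') = S.endFlag (S.endFlag f l) l' := by
  induction l generalizing f with
  | nil => simp [endFlag]
  | cons m l ih => simp [endFlag, ih]

theorem crossedSides_append (l l' : List Step) (f : S.Flag) :
    S.crossedSides f (l ++ l') = S.crossedSides f l ++ S.crossedSides (S.endFlag f l) l' := by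
  induction l generalizing f with
  | nil => simp [endFlag, crossedSides]
  | cons m l ih => cases m <;> simp [endFlag, crossedSides, ih]

namespace CrossingSequence

variable (w : S.CrossingSequence) (o₀ : ℤˣ)

/-! ## A standard M-path -/

theorem orientNE_eq (k : ℕ) : w.orientNE o₀ k = w.orientSW o₀ k * S.twist (w.side k) := by
  simp [orientNE, orientSW, orient, mul_assoc]

/-- The triangle between two crossings is drawn twice, in tile `k` and in tile `k + 1`, with
opposite orientations. -/
theorem orientNE_eq_neg (k : ℕ) : w.orientNE o₀ k = -w.orientSW o₀ (k + 1) := by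
  simp [orientNE, orientSW, pow_succ]

theorem orient_eq_mul_prod (k : ℕ) :
    w.orient o₀ k = o₀ * ∏ j ∈ Finset.range k, S.twist (w.side j) := by
  induction k with
  | zero => simp [orient]
  | succ k ih => rw [orient, ih, Finset.prod_range_succ, mul_assoc]

-- One-sidedness enters here: carried once around, the orientation is reversed, and the alternation
-- of tiles contributes (-1)^len.
variable {w} in
theorem IsOneSided.orientSW_len (hw : w.IsOneSided) :
    w.orientSW o₀ w.len = -((-1) ^ w.len * o₀) := by
  rw [orientSW, orient_eq_mul_prod, show _ = (-1 : ℤˣ) from hw]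
  simp

theorem orientSW_zero : w.orientSW o₀ 0 = o₀ := by simp [orientSW, orient]

theorem side_len : w.side w.len = w.side 0 := by simpa using w.periodic 0

theorem northSide_eq (k : ℕ) : w.northSide o₀ k =
    ((S.opp (w.side k)).1, (S.opp (w.side k)).2 - shift (w.orientSW o₀ (k + 1))) := by
  rw [northSide, orientNE_eq_neg, shift_neg, sub_eq_add_neg]

theorem eastSide_eq (k : ℕ) : w.eastSide o₀ k =
    ((S.opp (w.side k)).1, (S.opp (w.side k)).2 + shift (w.orientSW o₀ (k + 1))) := by
  rw [eastSide, orientNE_eq_neg, shift_neg, sub_neg_eq_add]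

variable {w o₀} in
theorem side_succ_of_not_glueEast {k : ℕ} (h : ¬ w.GlueEast o₀ k) :
    w.side (k + 1) = w.eastSide o₀ k := by
  rcases eq_or_eq_add_shift_or_eq_sub_shift (S.opp (w.side k)).2 (w.side (k + 1)).2
    (w.orientSW o₀ (k + 1)) with h' | h' | h'
  · exact absurd (Prod.ext (w.next k) h') (w.reduced k)
  · rw [eastSide_eq]
    exact Prod.ext (w.next k) h'
  · refine absurd ?_ h
    rw [GlueEast, northSide_eq]
    exact Prod.ext (w.next k) h'

open Classical in
/-- The third side of the triangle between crossings `k` and `k + 1`. -/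
noncomputable def thirdSide (k : ℕ) : S.Side :=
  if w.GlueEast o₀ k then w.eastSide o₀ k else w.northSide o₀ k

/-- The flag in front of crossing `k` at the northwest end of the diagonal of tile `k`. -/
def flagNW (k : ℕ) : S.Flag := (w.side k, w.orientSW o₀ k)

open Classical in
/-- Elementary steps from `flagNW k` to `flagNW (k + 1)`. -/
noncomputable def blockSteps (k : ℕ) : List Step :=
  if w.GlueEast o₀ k then [.cross, .turn, .slide] else [.cross, .slide, .turn]

theorem cross_flagNW (k : ℕ) :
    S.cross (w.flagNW o₀ k) = (S.opp (w.side k), w.orientSW o₀ (k + 1)) := by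
  have h := w.orientNE_eq_neg o₀ k
  rw [orientNE_eq] at h
  rw [cross, flagNW, mul_comm, h, neg_neg]

theorem endFlag_blockSteps (k : ℕ) :
    S.endFlag (w.flagNW o₀ k) (w.blockSteps o₀ k) = w.flagNW o₀ (k + 1) := by
  by_cases h : w.GlueEast o₀ k
  · have h' : w.side (k + 1) = w.northSide o₀ k := h
    simp only [blockSteps, if_pos h, endFlag, Step.target, cross_flagNW]
    rw [flagNW, h', northSide_eq]
    simp [turn, slide]
  · simp only [blockSteps, if_neg h, endFlag, Step.target, cross_flagNW]
    rw [flagNW, side_succ_of_not_glueEast h, eastSide_eq]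
    simp [turn, slide, shift_neg]

theorem crossedSides_blockSteps (k : ℕ) :
    S.crossedSides (w.flagNW o₀ k) (w.blockSteps o₀ k) = [w.side k] := by
  by_cases h : w.GlueEast o₀ k <;> simp [blockSteps, h, crossedSides, flagNW]

open Classical in
/-- The weighted adjacency of the diagonals of tiles `k` and `k + 1`: the entry at `(i', i)` is the label
of the edge used when the alternating path starts diagonal `k` at its northwest (`i = 0`) or
southeast (`i = 1`) end, and diagonal `k + 1` at its northwest (`i' = 0`) or southeast (`i' = 1`) end. -/
noncomputable def transferMatrix (x : S.Edge → K) (k : ℕ) : Matrix (Fin 2) (Fin 2) K :=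
  if w.GlueEast o₀ k then
    !![x (S.edge (w.thirdSide o₀ k)), x (S.edge (w.side (k + 1))); x (S.edge (w.side k)), 0]
  else
    !![0, x (S.edge (w.side k)); x (S.edge (w.side (k + 1))), x (S.edge (w.thirdSide o₀ k))]

/-- The rescaling of the coordinates at `flagNW k` that makes all transfer matrices positive. -/
noncomputable def scaling (x : S.Edge → K) (k : ℕ) : Matrix (Fin 2) (Fin 2) K :=
  !![1, 0; 0, -((w.orientSW o₀ k : ℤ) : K) * x (S.edge (w.side k))]

/-- The scaling absorbs the signs that depend on orientation and the asymmetry between x and 1/x in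
a slide. What remains is a global sign, the factor 1/x of the crossed arc, and a matrix of labels.
-/
theorem scaling_mul_refPathMatrix_blockSteps (L : S.PrincipalLamination) (x y : S.Edge → K)
    (hx : ∀ e, x e ≠ 0) (k : ℕ) :
    ∃ u : ℤˣ, w.scaling o₀ x (k + 1) * refPathMatrix L x y (w.flagNW o₀ k) (w.blockSteps o₀ k) =
      ((u : ℤ) : K) • (x (S.edge (w.side k)))⁻¹ • (w.transferMatrix o₀ x k *
        crossMatrix L y (w.side k) (w.orientSW o₀ k) * w.scaling o₀ x k) := by
  have h0 := hx (S.edge (w.side k))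
  have h1 := hx (S.edge (w.side (k + 1)))
  -- The twist compares the plane orientations of consecutive tiles; the extra sign comes from their
  -- alternating embedding.
  have ht : S.twist (w.side k) = -w.orientSW o₀ k * w.orientSW o₀ (k + 1) := by
    rw [neg_mul_comm, ← orientNE_eq_neg, orientNE_eq, ← mul_assoc]
    rcases Int.units_eq_one_or (w.orientSW o₀ k) with h | h <;> rw [h] <;> simp
  obtain ⟨y₁, y₂, hy⟩ : ∃ y₁ y₂ : K,
      crossMatrix L y (w.side k) (w.orientSW o₀ k) = !![y₁, 0; 0, y₂] := ⟨_, _, rfl⟩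
  have hcross : Step.cross.refMatrix L x y (w.flagNW o₀ k) =
      signMatrix K (-w.orientSW o₀ k * w.orientSW o₀ (k + 1)) * !![y₁, 0; 0, y₂] := by
    rw [← ht, ← hy]
    rfl
  by_cases h : w.GlueEast o₀ k
  · have h' : w.side (k + 1) = w.northSide o₀ k := h
    have hturn : S.turn (S.opp (w.side k), w.orientSW o₀ (k + 1)) =
        (w.side (k + 1), -w.orientSW o₀ (k + 1)) := by
      rw [h', northSide_eq, turn]
    have hthird : S.oppositeSide (S.opp (w.side k), w.orientSW o₀ (k + 1)) = w.thirdSide o₀ k := by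
      rw [thirdSide, if_pos h, eastSide_eq, oppositeSide]
    refine ⟨1, ?_⟩
    rw [blockSteps, if_pos h]
    simp only [refPathMatrix, Step.target]
    rw [hcross, cross_flagNW, hturn, hy]
    simp only [Step.refMatrix, hturn, hthird, edge_opp, transferMatrix, if_pos h, scaling,
      signMatrix]
    rcases Int.units_eq_one_or (w.orientSW o₀ k) with e | e <;>
    rcases Int.units_eq_one_or (w.orientSW o₀ (k + 1)) with e' | e' <;> rw [e, e'] <;>
    ext i j <;> fin_cases i <;> fin_cases j <;> simp <;> field_simp
  · have hturn : S.turn (S.opp (w.side k), -w.orientSW o₀ (k + 1)) =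
        (w.side (k + 1), w.orientSW o₀ (k + 1)) := by
      rw [side_succ_of_not_glueEast h, eastSide_eq, turn]
      simp [shift_neg]
    have hthird : S.oppositeSide (S.opp (w.side k), -w.orientSW o₀ (k + 1)) =
        w.thirdSide o₀ k := by
      rw [thirdSide, if_neg h, northSide_eq, oppositeSide, shift_neg, sub_eq_add_neg]
    refine ⟨-1, ?_⟩
    rw [blockSteps, if_neg h]
    simp only [refPathMatrix, Step.target]
    rw [hcross, cross_flagNW, slide, hy]
    simp only [Step.refMatrix, hturn, hthird, edge_opp, transferMatrix, if_neg h, scaling,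
      signMatrix]
    rcases Int.units_eq_one_or (w.orientSW o₀ k) with e | e <;>
    rcases Int.units_eq_one_or (w.orientSW o₀ (k + 1)) with e' | e' <;> rw [e, e'] <;>
    ext i j <;> fin_cases i <;> fin_cases j <;> simp <;> field_simp

/-- Elementary steps from `flagNW 0` to `flagNW k`. -/
noncomputable def initialSteps : ℕ → List Step
  | 0 => []
  | k + 1 => initialSteps k ++ w.blockSteps o₀ k

theorem endFlag_initialSteps (k : ℕ) :
    S.endFlag (w.flagNW o₀ 0) (w.initialSteps o₀ k) = w.flagNW o₀ k := by
  induction k with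
  | zero => simp [initialSteps, endFlag]
  | succ k ih => rw [initialSteps, endFlag_append, ih, endFlag_blockSteps]

theorem crossedSides_initialSteps (k : ℕ) :
    S.crossedSides (w.flagNW o₀ 0) (w.initialSteps o₀ k) = (List.range k).map w.side := by
  induction k with
  | zero => simp [initialSteps, crossedSides]
  | succ k ih =>
    rw [initialSteps, crossedSides_append, ih, endFlag_initialSteps, crossedSides_blockSteps,
      List.range_succ, List.map_append, List.map_singleton]

/-- The product of the first `k` weighted transfer matrices. -/
noncomputable def transferProduct (L : S.PrincipalLamination) (x y : S.Edge → K) :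
    ℕ → Matrix (Fin 2) (Fin 2) K
  | 0 => 1
  | k + 1 => w.transferMatrix o₀ x k * crossMatrix L y (w.side k) (w.orientSW o₀ k) *
      transferProduct L x y k

theorem scaling_mul_refPathMatrix_initialSteps (L : S.PrincipalLamination) (x y : S.Edge → K)
    (hx : ∀ e, x e ≠ 0) (k : ℕ) :
    ∃ u : ℤˣ, w.scaling o₀ x k * refPathMatrix L x y (w.flagNW o₀ 0) (w.initialSteps o₀ k) =
      ((u : ℤ) : K) • (∏ j ∈ Finset.range k, x (S.edge (w.side j)))⁻¹ •
        (w.transferProduct o₀ L x y k * w.scaling o₀ x 0) := by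
  induction k with
  | zero => exact ⟨1, by simp [initialSteps, refPathMatrix, transferProduct]⟩
  | succ k ih =>
    obtain ⟨u, hu⟩ := ih
    obtain ⟨u', hu'⟩ := w.scaling_mul_refPathMatrix_blockSteps o₀ L x y hx k
    refine ⟨u' * u, ?_⟩
    rw [initialSteps, refPathMatrix_append, endFlag_initialSteps, ← Matrix.mul_assoc, hu',
      Matrix.smul_mul, Matrix.smul_mul, Matrix.mul_assoc _ (w.scaling o₀ x k), hu,
      Finset.prod_range_succ, transferProduct]
    simp only [Matrix.mul_smul, smul_smul, Matrix.mul_assoc, Units.val_mul, Int.cast_mul, mul_inv]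
    congr 1
    ring

/-- The permutation of the ends of a diagonal which compares tile `len` with tile `0`. -/
def closingPerm : Equiv.Perm (Fin 2) := if Even w.len then Equiv.swap 0 1 else 1

/-- A closed path that crosses the same sides as the curve. -/
noncomputable def standardPath : S.StepPath where
  start := w.flagNW o₀ 0
  steps := w.initialSteps o₀ w.len ++ if Even w.len then [.slide] else []

variable {w}

theorem IsOneSided.flagNW_len (hw : w.IsOneSided) :
    w.flagNW o₀ w.len = (w.side 0, if Even w.len then -o₀ else o₀) := by
  rw [flagNW, side_len, hw.orientSW_len]
  split_ifs with h
  · simp [h.neg_one_pow]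
  · simp [(Nat.not_even_iff_odd.1 h).neg_one_pow]

theorem IsOneSided.isMPath_standardPath (hw : w.IsOneSided) :
    (w.standardPath o₀).IsMPath w := by
  constructor
  · rw [standardPath, endFlag_append, endFlag_initialSteps, hw.flagNW_len, flagNW, orientSW_zero]
    split_ifs <;> simp [endFlag, Step.target, slide]
  · rw [standardPath, crossedSides_append, crossedSides_initialSteps]
    split_ifs <;> simp [crossedSides, List.IsRotated.refl]

theorem IsOneSided.trace_standardPath (hw : w.IsOneSided) (L : S.PrincipalLamination)
    (x y : S.Edge → K) (hx : ∀ e, x e ≠ 0) :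
    ∃ u : ℤˣ, (refPathMatrix L x y (w.standardPath o₀).start (w.standardPath o₀).steps).trace =
      ((u : ℤ) : K) * ((w.crossingMonomial x)⁻¹ *
        ∑ i, w.transferProduct o₀ L x y w.len (w.closingPerm i) i) := by
  obtain ⟨u, hu⟩ := w.scaling_mul_refPathMatrix_initialSteps o₀ L x y hx w.len
  refine ⟨u, ?_⟩
  have h0 := hx (S.edge (w.side 0))
  have hdet : IsUnit (w.scaling o₀ x 0).det := by
    rcases Int.units_eq_one_or o₀ with rfl | rfl <;>
      simp [scaling, Matrix.det_fin_two_of, orientSW_zero, h0]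
  -- If D is the initial scaling, A is the D-conjugate of a multiple of B Q. Here B is the closing
  -- matrix: the swap when `len` is even, the identity otherwise.
  have key : ∀ A B Q : Matrix (Fin 2) (Fin 2) K, ∀ c d : K,
      w.scaling o₀ x 0 * A = B * c • d • (Q * w.scaling o₀ x 0) →
        A.trace = c * (d * (B * Q).trace) := by
    intro A B Q c d h
    have h' := congrArg (fun M => ((w.scaling o₀ x 0)⁻¹ * M).trace) h
    simp only [← Matrix.mul_assoc, Matrix.nonsing_inv_mul _ hdet, Matrix.one_mul, Matrix.mul_smul,
      Matrix.trace_smul, smul_eq_mul] at h'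
    rw [h', Matrix.mul_assoc, Matrix.mul_assoc, Matrix.trace_mul_comm, Matrix.mul_assoc,
      Matrix.mul_assoc, Matrix.mul_nonsing_inv _ hdet, Matrix.mul_one]
  by_cases h : Even w.len
  -- For even `len` the path arrives at the other end of the first side; in rescaled coordinates the
  -- slide back is exactly the swap.
  · have hs : w.scaling o₀ x 0 * Step.slide.refMatrix L x y (w.flagNW o₀ w.len) =
        !![0, 1; 1, 0] * w.scaling o₀ x w.len := by
      rw [hw.flagNW_len, if_pos h]
      simp only [scaling, side_len, hw.orientSW_len, h.neg_one_pow, orientSW_zero, Step.refMatrix]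
      rcases Int.units_eq_one_or o₀ with rfl | rfl <;>
        ext i j <;> fin_cases i <;> fin_cases j <;> simp [h0]
    simp only [standardPath, if_pos h, refPathMatrix_append, endFlag_initialSteps, refPathMatrix,
      Matrix.one_mul]
    rw [key _ !![0, 1; 1, 0] _ _ _ (by rw [← Matrix.mul_assoc, hs, Matrix.mul_assoc, hu])]
    rw [Matrix.trace_fin_two, Matrix.mul_apply, Matrix.mul_apply]
    simp [closingPerm, h, crossingMonomial]
  · have hs : w.scaling o₀ x w.len = w.scaling o₀ x 0 := by
      simp only [scaling, side_len, hw.orientSW_len, (Nat.not_even_iff_odd.1 h).neg_one_pow,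
        orientSW_zero]
      simp
    simp only [standardPath, if_neg h, List.append_nil]
    rw [hs] at hu
    rw [key _ 1 _ _ _ (by rw [hu, Matrix.one_mul])]
    simp [closingPerm, h, crossingMonomial, Matrix.trace]

end CrossingSequence

namespace CrossingSequence

variable (w : S.CrossingSequence) (o₀ : ℤˣ)

/-! ## The edges of the snake graph, by antidiagonals -/

open Classical in
/-- The end of diagonal `k + 1` which is the northeast vertex of tile `k`: northwest (`0`) or
southeast (`1`). -/
noncomputable def glueIndex (k : ℕ) : Fin 2 := if w.GlueEast o₀ k then 0 else 1

/-- The northwest (`0`) or southeast (`1`) end of the diagonal of tile `k`. -/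
noncomputable def diagonalEnd (k : ℕ) (i : Fin 2) : ℤ × ℤ :=
  if i = 0 then w.cornerNW o₀ k else w.cornerSE o₀ k

/-- The southwest corner of the first tile (`j = 0`), or the end of diagonal `j - 1` other than `i`. -/
noncomputable def lowerEnd : ℕ → Fin 2 → ℤ × ℤ
  | 0, _ => w.cornerSW o₀ 0
  | k + 1, i => w.diagonalEnd o₀ k (i + 1)

/-- The side which labels the edge `edgeAt j i i'`. -/
noncomputable def edgeSide : ℕ → Fin 2 → Fin 2 → S.Side
  | 0, _, i' => if i' = 0 then w.westSide o₀ 0 else w.southSide o₀ 0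
  | k + 1, i, i' =>
    if i = w.glueIndex o₀ k then
      if i' = w.glueIndex o₀ k then w.thirdSide o₀ k else w.side k
    else w.side (k + 1)

/-- The edge from `lowerEnd j i` to `diagonalEnd j i'`. -/
noncomputable def edgeAt (j : ℕ) (i i' : Fin 2) : Sym2 (ℤ × ℤ) × S.Edge :=
  (s(w.lowerEnd o₀ j i, w.diagonalEnd o₀ j i'), S.edge (w.edgeSide o₀ j i i'))

/-- The edge `edgeAt j i i'` belongs to the snake graph. -/
def IsEdgeIndex : ℕ → Fin 2 → Fin 2 → Prop
  | 0, _, _ => True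
  | k + 1, i, i' => (i = w.glueIndex o₀ k ∨ i' = w.glueIndex o₀ k) ∧
      (k + 1 = w.len → i' = w.glueIndex o₀ k)

theorem tilePos_fst_add_snd (k : ℕ) : (w.tilePos o₀ k).1 + (w.tilePos o₀ k).2 = k := by
  induction k with
  | zero => simp [tilePos]
  | succ k ih =>
    rw [tilePos]
    split_ifs <;> simp <;> linarith

/-- The coordinate sum serves as a level: both ends of diagonal `k` lie on level `k + 1`, and
`edgeAt j` joins level `j` to level `j + 1`. All later disjointness arguments compare levels. -/
theorem level_diagonalEnd (k : ℕ) (i : Fin 2) :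
    (w.diagonalEnd o₀ k i).1 + (w.diagonalEnd o₀ k i).2 = k + 1 := by
  have := w.tilePos_fst_add_snd o₀ k
  unfold diagonalEnd cornerNW cornerSE
  split_ifs <;> simp <;> linarith

theorem level_lowerEnd (j : ℕ) (i : Fin 2) :
    (w.lowerEnd o₀ j i).1 + (w.lowerEnd o₀ j i).2 = j := by
  cases j with
  | zero => simp [lowerEnd, cornerSW, tilePos]
  | succ k => simpa [lowerEnd] using w.level_diagonalEnd o₀ k (i + 1)

variable {w o₀} in
theorem diagonalEnd_inj {k : ℕ} {i i' : Fin 2}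
    (h : w.diagonalEnd o₀ k i = w.diagonalEnd o₀ k i') : i = i' := by
  revert h
  fin_cases i <;> fin_cases i' <;> simp [diagonalEnd, cornerNW, cornerSE, Prod.ext_iff]

theorem mem_edgeAt {j : ℕ} {i i' : Fin 2} {v : ℤ × ℤ} :
    v ∈ (w.edgeAt o₀ j i i').1 ↔ v = w.lowerEnd o₀ j i ∨ v = w.diagonalEnd o₀ j i' := by
  simp [edgeAt]

theorem westEdge_zero (i : Fin 2) : w.westEdge o₀ 0 = w.edgeAt o₀ 0 i 0 := by
  simp [westEdge, edgeAt, lowerEnd, diagonalEnd, edgeSide]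

theorem southEdge_zero (i : Fin 2) : w.southEdge o₀ 0 = w.edgeAt o₀ 0 i 1 := by
  simp [southEdge, edgeAt, lowerEnd, diagonalEnd, edgeSide]

theorem diagonalEnd_glueIndex (k : ℕ) :
    w.diagonalEnd o₀ (k + 1) (w.glueIndex o₀ k) = w.cornerNE o₀ k := by
  unfold diagonalEnd glueIndex
  split_ifs with h1 h2 h2 <;> simp_all [cornerNW, cornerSE, cornerNE, tilePos, add_assoc]

theorem eastEdge_eq (k : ℕ) : w.eastEdge o₀ k = w.edgeAt o₀ (k + 1) 0 (w.glueIndex o₀ k) := by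
  rw [edgeAt, diagonalEnd_glueIndex, eastEdge]
  by_cases h : w.GlueEast o₀ k
  · simp [lowerEnd, diagonalEnd, edgeSide, glueIndex, h, thirdSide]
  · simp [lowerEnd, diagonalEnd, edgeSide, glueIndex, h, side_succ_of_not_glueEast h]

theorem northEdge_eq (k : ℕ) : w.northEdge o₀ k = w.edgeAt o₀ (k + 1) 1 (w.glueIndex o₀ k) := by
  rw [edgeAt, diagonalEnd_glueIndex, northEdge]
  by_cases h : w.GlueEast o₀ k
  · have h' : w.side (k + 1) = w.northSide o₀ k := h
    simp [lowerEnd, diagonalEnd, edgeSide, glueIndex, h, h']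
  · simp [lowerEnd, diagonalEnd, edgeSide, glueIndex, h, thirdSide]

variable {w o₀} in
theorem southSide_succ_of_glueEast {k : ℕ} (h : w.GlueEast o₀ k) :
    w.southSide o₀ (k + 1) = S.opp (w.side k) := by
  have h' : w.side (k + 1) = w.northSide o₀ k := h
  rw [southSide, h', northSide_eq]
  simp

variable {w o₀} in
theorem westSide_succ_of_glueEast {k : ℕ} (h : w.GlueEast o₀ k) :
    w.westSide o₀ (k + 1) = w.thirdSide o₀ k := by
  have h' : w.side (k + 1) = w.northSide o₀ k := h
  rw [westSide, h', northSide_eq, thirdSide, if_pos h, eastSide_eq, sub_shift_sub_shift]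

variable {w o₀} in
theorem westSide_succ_of_not_glueEast {k : ℕ} (h : ¬ w.GlueEast o₀ k) :
    w.westSide o₀ (k + 1) = S.opp (w.side k) := by
  rw [westSide, side_succ_of_not_glueEast h, eastSide_eq]
  simp

variable {w o₀} in
theorem southSide_succ_of_not_glueEast {k : ℕ} (h : ¬ w.GlueEast o₀ k) :
    w.southSide o₀ (k + 1) = w.thirdSide o₀ k := by
  rw [southSide, side_succ_of_not_glueEast h, eastSide_eq, thirdSide, if_neg h, northSide_eq,
    add_shift_add_shift]

theorem southEdge_succ (k : ℕ) : w.southEdge o₀ (k + 1) =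
    w.edgeAt o₀ (k + 1) (w.glueIndex o₀ k) 1 := by
  by_cases h : w.GlueEast o₀ k
  · simp [southEdge, edgeAt, lowerEnd, diagonalEnd, edgeSide, glueIndex, h,
      southSide_succ_of_glueEast h, edge_opp, cornerSW, cornerSE, tilePos]
  · simp [southEdge, edgeAt, lowerEnd, diagonalEnd, edgeSide, glueIndex, h,
      southSide_succ_of_not_glueEast h, cornerSW, cornerSE, cornerNW, tilePos]

theorem westEdge_succ (k : ℕ) : w.westEdge o₀ (k + 1) =
    w.edgeAt o₀ (k + 1) (w.glueIndex o₀ k) 0 := by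
  by_cases h : w.GlueEast o₀ k
  · simp [westEdge, edgeAt, lowerEnd, diagonalEnd, edgeSide, glueIndex, h,
      westSide_succ_of_glueEast h, cornerSW, cornerSE, cornerNW, tilePos]
  · simp [westEdge, edgeAt, lowerEnd, diagonalEnd, edgeSide, glueIndex, h,
      westSide_succ_of_not_glueEast h, edge_opp, cornerSW, cornerNW, tilePos]

theorem eq_zero_or_eq_one (i : Fin 2) : i = 0 ∨ i = 1 := by
  revert i
  decide

/-- Of the four pairs of ends of diagonals `k` and `k + 1`, three are edges: two from tile `k` into
its northeast vertex and two from the southwest vertex of tile `k + 1`, with the shared edge counted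
twice. After the last tile only the first two remain. -/
theorem mem_snakeEdges {e : Sym2 (ℤ × ℤ) × S.Edge} :
    e ∈ w.snakeEdges o₀ ↔
      ∃ j ≤ w.len, ∃ i i', w.IsEdgeIndex o₀ j i i' ∧ e = w.edgeAt o₀ j i i' := by
  simp only [snakeEdges, Finset.mem_biUnion, Finset.mem_range, Finset.mem_insert,
    Finset.mem_singleton]
  constructor
  · rintro ⟨k, hk, rfl | rfl | rfl | rfl⟩
    · cases k with
      | zero => exact ⟨0, by omega, 0, 1, trivial, w.southEdge_zero o₀ 0⟩
      | succ k =>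
        -- Tile `k + 1` exists, so this is not the last level.
        exact ⟨k + 1, by omega, _, _, ⟨Or.inl rfl, fun h => absurd h (by omega)⟩,
          w.southEdge_succ o₀ k⟩
    · cases k with
      | zero => exact ⟨0, by omega, 0, 0, trivial, w.westEdge_zero o₀ 0⟩
      | succ k =>
        exact ⟨k + 1, by omega, _, _, ⟨Or.inl rfl, fun h => absurd h (by omega)⟩,
          w.westEdge_succ o₀ k⟩
    · exact ⟨k + 1, hk, _, _, ⟨Or.inr rfl, fun _ => rfl⟩, w.northEdge_eq o₀ k⟩
    · exact ⟨k + 1, hk, _, _, ⟨Or.inr rfl, fun _ => rfl⟩, w.eastEdge_eq o₀ k⟩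
  · rintro ⟨j, hj, i, i', h, rfl⟩
    cases j with
    | zero =>
      refine ⟨0, w.len_pos, ?_⟩
      rcases eq_zero_or_eq_one i' with rfl | rfl
      · simp [← westEdge_zero]
      · simp [← southEdge_zero]
    | succ k =>
      by_cases hi' : i' = w.glueIndex o₀ k
      · refine ⟨k, hj, ?_⟩
        rw [hi']
        rcases eq_zero_or_eq_one i with rfl | rfl
        · simp [← eastEdge_eq]
        · simp [← northEdge_eq]
      · have hi : i = w.glueIndex o₀ k := h.1.resolve_right hi'
        refine ⟨k + 1, lt_of_le_of_ne hj fun hk => hi' (h.2 hk), ?_⟩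
        rw [hi]
        rcases eq_zero_or_eq_one i' with rfl | rfl
        · simp [← westEdge_succ]
        · simp [← southEdge_succ]

theorem isSnakeVertex_lowerEnd_zero (i : Fin 2) : w.IsSnakeVertex o₀ (w.lowerEnd o₀ 0 i) :=
  ⟨w.edgeAt o₀ 0 i 0, (w.mem_snakeEdges o₀).2 ⟨0, Nat.zero_le _, _, _, trivial, rfl⟩, by
    simp [mem_edgeAt]⟩

theorem isSnakeVertex_diagonalEnd {k : ℕ} (hk : k < w.len) (i : Fin 2) :
    w.IsSnakeVertex o₀ (w.diagonalEnd o₀ k i) := by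
  refine ⟨w.edgeAt o₀ (k + 1) (i + 1) (w.glueIndex o₀ k),
    (w.mem_snakeEdges o₀).2 ⟨k + 1, hk, _, _, ⟨Or.inr rfl, fun _ => rfl⟩, rfl⟩, ?_⟩
  rw [mem_edgeAt, lowerEnd, add_assoc, show (1 : Fin 2) + 1 = 0 from rfl, add_zero]
  exact Or.inl rfl

theorem IsSnakeVertex.cases {v : ℤ × ℤ} (hv : w.IsSnakeVertex o₀ v) :
    v = w.lowerEnd o₀ 0 0 ∨ (∃ k < w.len, ∃ i, v = w.diagonalEnd o₀ k i) ∨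
      v = w.diagonalEnd o₀ w.len (w.glueIndex o₀ (w.len - 1)) := by
  obtain ⟨e, he, hv⟩ := hv
  obtain ⟨j, hj, i, i', hi, rfl⟩ := (w.mem_snakeEdges o₀).1 he
  rcases (w.mem_edgeAt o₀).1 hv with rfl | rfl
  · cases j with
    | zero => exact Or.inl rfl
    | succ k => exact Or.inr (Or.inl ⟨k, hj, _, rfl⟩)
  · rcases hj.lt_or_eq with hj | rfl
    · exact Or.inr (Or.inl ⟨j, hj, _, rfl⟩)
    · obtain ⟨m, hm⟩ : ∃ m, w.len = m + 1 := ⟨w.len - 1, by have := w.len_pos; omega⟩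
      rw [hm] at hi
      rw [hi.2 hm.symm, hm]
      exact Or.inr (Or.inr rfl)

/-! ## Perfect matchings as sequences of ends of diagonals -/

/-- The edges selected by a sequence: the `j`-th one ends at the end `a j` of diagonal `j`, and the next
one starts at the other end of this diagonal. -/
noncomputable def matchingEdge (a : ℕ → Fin 2) (j : ℕ) : Sym2 (ℤ × ℤ) × S.Edge :=
  w.edgeAt o₀ j (a (j - 1)) (a j)

open Classical in
/-- The set of edges selected by a sequence. -/
noncomputable def matchingOf (a : ℕ → Fin 2) : Finset (Sym2 (ℤ × ℤ) × S.Edge) :=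
  (Finset.range (w.len + 1)).image (w.matchingEdge o₀ a)

/-- The sequences that describe perfect matchings. -/
def IsAdmissible (a : ℕ → Fin 2) : Prop :=
  a w.len = w.glueIndex o₀ (w.len - 1) ∧
    ∀ k < w.len, a k = w.glueIndex o₀ k ∨ a (k + 1) = w.glueIndex o₀ k

variable {w o₀}

theorem mem_matchingOf {a : ℕ → Fin 2} {e : Sym2 (ℤ × ℤ) × S.Edge} :
    e ∈ w.matchingOf o₀ a ↔ ∃ j ≤ w.len, e = w.matchingEdge o₀ a j := by
  simp [matchingOf, eq_comm]

/-- Selected edges are pairwise disjoint: only consecutive ones could meet, on a diagonal, and there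
they use opposite ends. -/
theorem index_eq_of_mem_of_mem {a : ℕ → Fin 2} {j j' : ℕ} {v : ℤ × ℤ}
    (h : v ∈ (w.matchingEdge o₀ a j).1) (h' : v ∈ (w.matchingEdge o₀ a j').1) : j = j' := by
  have key : ∀ {j j' : ℕ}, v = w.lowerEnd o₀ j (a (j - 1)) → v ≠ w.diagonalEnd o₀ j' (a j') := by
    rintro j j' rfl h
    have h1 := congrArg (fun p => p.1 + p.2) h
    simp only [level_lowerEnd, level_diagonalEnd] at h1
    obtain rfl : j = j' + 1 := by omega
    -- Now `a (j - 1)` is `a j'`, so this would identify the ends `a j' + 1` and `a j'`.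
    have := diagonalEnd_inj h
    revert this
    simp
  rcases (w.mem_edgeAt o₀).1 h with h | h <;> rcases (w.mem_edgeAt o₀).1 h' with h' | h'
  · have h1 := congrArg (fun p => p.1 + p.2) (h.symm.trans h')
    simp only [level_lowerEnd] at h1
    omega
  · exact absurd h' (key h)
  · exact absurd h (key h')
  · have h1 := congrArg (fun p => p.1 + p.2) (h.symm.trans h')
    simp only [level_diagonalEnd] at h1
    omega

theorem matchingEdge_injective (a : ℕ → Fin 2) : Function.Injective (w.matchingEdge o₀ a) := by
  intro j j' h
  refine index_eq_of_mem_of_mem (v := w.diagonalEnd o₀ j (a j)) ((w.mem_edgeAt o₀).2 (Or.inr rfl)) ?_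
  rw [← h]
  exact (w.mem_edgeAt o₀).2 (Or.inr rfl)

theorem edgeAt_index_eq {j j' : ℕ} {i i' l l' : Fin 2}
    (h : w.edgeAt o₀ j i i' = w.edgeAt o₀ j' l l') : j = j' := by
  have h1 : w.diagonalEnd o₀ j i' ∈ (w.edgeAt o₀ j' l l').1 := by
    rw [← h]
    exact (w.mem_edgeAt o₀).2 (Or.inr rfl)
  have h2 : w.lowerEnd o₀ j i ∈ (w.edgeAt o₀ j' l l').1 := by
    rw [← h]
    exact (w.mem_edgeAt o₀).2 (Or.inl rfl)
  rcases (w.mem_edgeAt o₀).1 h1 with h1 | h1 <;> rcases (w.mem_edgeAt o₀).1 h2 with h2 | h2 <;>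
    (have h1 := congrArg (fun p => p.1 + p.2) h1
     have h2 := congrArg (fun p => p.1 + p.2) h2
     simp only [level_diagonalEnd, level_lowerEnd] at h1 h2
     omega)

theorem edgeAt_upper_eq {j : ℕ} {i i' l l' : Fin 2}
    (h : w.edgeAt o₀ j i i' = w.edgeAt o₀ j l l') : i' = l' := by
  have h1 : w.diagonalEnd o₀ j i' ∈ (w.edgeAt o₀ j l l').1 := by
    rw [← h]
    exact (w.mem_edgeAt o₀).2 (Or.inr rfl)
  rcases (w.mem_edgeAt o₀).1 h1 with h1 | h1
  · have h1 := congrArg (fun p => p.1 + p.2) h1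
    simp only [level_diagonalEnd, level_lowerEnd] at h1
    omega
  · exact diagonalEnd_inj h1

theorem edgeAt_lower_eq {k : ℕ} {i i' l l' : Fin 2}
    (h : w.edgeAt o₀ (k + 1) i i' = w.edgeAt o₀ (k + 1) l l') : i = l := by
  have h1 : w.lowerEnd o₀ (k + 1) i ∈ (w.edgeAt o₀ (k + 1) l l').1 := by
    rw [← h]
    exact (w.mem_edgeAt o₀).2 (Or.inl rfl)
  rcases (w.mem_edgeAt o₀).1 h1 with h1 | h1
  · exact add_right_cancel (diagonalEnd_inj h1)
  · have h1 := congrArg (fun p => p.1 + p.2) h1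
    simp only [level_diagonalEnd, level_lowerEnd] at h1
    omega

theorem eq_add_one_of_ne {i i' : Fin 2} (h : i ≠ i') : i = i' + 1 := by
  revert i i'
  decide

/-- Edge `k` covers the end `a k` of diagonal `k` and edge `k + 1` covers the other end; the first
and last edges cover the two extreme corners. -/
theorem IsAdmissible.isPerfectMatching {a : ℕ → Fin 2} (ha : w.IsAdmissible o₀ a) :
    w.IsPerfectMatching o₀ (w.matchingOf o₀ a) := by
  constructor
  · intro e he
    obtain ⟨j, hj, rfl⟩ := mem_matchingOf.1 he
    refine (w.mem_snakeEdges o₀).2 ⟨j, hj, _, _, ?_, rfl⟩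
    cases j with
    | zero => trivial
    | succ k =>
      refine ⟨ha.2 k hj, fun h => ?_⟩
      have := ha.1
      rwa [← h] at this
  · intro v hv
    obtain ⟨j, hj, hv⟩ : ∃ j ≤ w.len, v ∈ (w.matchingEdge o₀ a j).1 := by
      rcases hv.cases with rfl | ⟨k, hk, i, rfl⟩ | rfl
      · exact ⟨0, Nat.zero_le _, (w.mem_edgeAt o₀).2 (Or.inl rfl)⟩
      · by_cases hi : i = a k
        · exact ⟨k, hk.le, (w.mem_edgeAt o₀).2 (Or.inr (by rw [hi]))⟩
        · refine ⟨k + 1, hk, (w.mem_edgeAt o₀).2 (Or.inl ?_)⟩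
          rw [eq_add_one_of_ne hi]
          rfl
      · exact ⟨w.len, le_rfl, (w.mem_edgeAt o₀).2 (Or.inr (by rw [ha.1]))⟩
    refine ⟨_, ⟨mem_matchingOf.2 ⟨j, hj, rfl⟩, hv⟩, ?_⟩
    rintro e ⟨he, hve⟩
    obtain ⟨j', -, rfl⟩ := mem_matchingOf.1 he
    rw [index_eq_of_mem_of_mem hve hv]

theorem matchingOf_inj {a a' : ℕ → Fin 2} (h : w.matchingOf o₀ a = w.matchingOf o₀ a') {k : ℕ}
    (hk : k ≤ w.len) : a k = a' k := by
  have h1 : w.matchingEdge o₀ a k ∈ w.matchingOf o₀ a' := by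
    rw [← h]
    exact mem_matchingOf.2 ⟨k, hk, rfl⟩
  obtain ⟨j, -, h2⟩ := mem_matchingOf.1 h1
  obtain rfl := edgeAt_index_eq h2
  exact edgeAt_upper_eq h2

/-- A perfect matching is forced level by level: the southwest corner is matched upwards, and on
each diagonal one end is taken from below, so the other must be matched upwards. -/
theorem IsPerfectMatching.exists_eq_matchingOf {P : Finset (Sym2 (ℤ × ℤ) × S.Edge)}
    (hP : w.IsPerfectMatching o₀ P) : ∃ a, w.IsAdmissible o₀ a ∧ P = w.matchingOf o₀ a := by
  classical
  have hsnake : ∀ e ∈ P, ∃ j ≤ w.len, ∃ i i', w.IsEdgeIndex o₀ j i i' ∧ e = w.edgeAt o₀ j i i' :=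
    fun e he => (w.mem_snakeEdges o₀).1 (hP.1 he)
  have huniq : ∀ v, w.IsSnakeVertex o₀ v → ∀ e ∈ P, ∀ e' ∈ P, v ∈ e.1 → v ∈ e'.1 → e = e' :=
    fun v hv e he e' he' h h' => (hP.2 v hv).unique ⟨he, h⟩ ⟨he', h'⟩
  -- Reads off the upper end of the edge of P at level `j`; `key` shows that there is exactly one
  -- such edge for `j ≤ w.len`.
  let a : ℕ → Fin 2 := fun j => if ∃ i, w.edgeAt o₀ j i 0 ∈ P then 0 else 1
  have ha : ∀ j i i', w.edgeAt o₀ j i i' ∈ P →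
      (∀ l l', w.edgeAt o₀ j l l' ∈ P → w.edgeAt o₀ j l l' = w.edgeAt o₀ j i i') → a j = i' := by
    intro j i i' h hu
    by_cases h0 : ∃ i, w.edgeAt o₀ j i 0 ∈ P
    · obtain ⟨l, hl⟩ := h0
      rw [← edgeAt_upper_eq (hu l 0 hl)]
      exact if_pos ⟨l, hl⟩
    · rcases eq_zero_or_eq_one i' with rfl | rfl
      · exact absurd ⟨i, h⟩ h0
      · exact if_neg h0
  have key : ∀ j ≤ w.len, w.matchingEdge o₀ a j ∈ P ∧
      ∀ l l', w.edgeAt o₀ j l l' ∈ P → w.edgeAt o₀ j l l' = w.matchingEdge o₀ a j := by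
    intro j
    induction j with
    | zero =>
      intro _
      obtain ⟨e, ⟨he, hv⟩, hu⟩ := hP.2 _ (w.isSnakeVertex_lowerEnd_zero o₀ 0)
      obtain ⟨j, hj, i, i', hi, rfl⟩ := hsnake e he
      have hj : j = 0 := by
        rcases (w.mem_edgeAt o₀).1 hv with h | h <;>
          (have h := congrArg (fun p => p.1 + p.2) h
           simp only [level_diagonalEnd, level_lowerEnd] at h
           omega)
      subst hj
      have hu' : ∀ l l', w.edgeAt o₀ 0 l l' ∈ P → w.edgeAt o₀ 0 l l' = w.edgeAt o₀ 0 i i' :=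
        fun l l' h => hu _ ⟨h, (w.mem_edgeAt o₀).2 (Or.inl rfl)⟩
      have h0 := ha 0 i i' he hu'
      have h1 : w.matchingEdge o₀ a 0 = w.edgeAt o₀ 0 i i' := by
        rw [matchingEdge, h0]
        rfl
      rw [h1]
      exact ⟨he, hu'⟩
    | succ k ih =>
      intro hk
      obtain ⟨h1, h2⟩ := ih (by omega)
      obtain ⟨e, ⟨he, hv⟩, hu⟩ := hP.2 _ (w.isSnakeVertex_diagonalEnd o₀ (k := k) hk (a k + 1))
      obtain ⟨j, hj, i, i', hi, rfl⟩ := hsnake e he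
      have hup : w.diagonalEnd o₀ k (a k + 1) ≠ w.diagonalEnd o₀ k (a k) := fun h => by
        have := diagonalEnd_inj h
        revert this
        simp
      have hjk : j = k + 1 ∧ i = a k := by
        rcases (w.mem_edgeAt o₀).1 hv with h | h
        · have h' := congrArg (fun p => p.1 + p.2) h
          simp only [level_diagonalEnd, level_lowerEnd] at h'
          obtain rfl : j = k + 1 := by omega
          exact ⟨rfl, (add_right_cancel (diagonalEnd_inj h)).symm⟩
        · have h' := congrArg (fun p => p.1 + p.2) h
          simp only [level_diagonalEnd] at h'
          obtain rfl : j = k := by omega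
          rw [edgeAt_upper_eq (h2 i i' he)] at h
          exact absurd h hup
      obtain ⟨rfl, rfl⟩ := hjk
      have hu' : ∀ l l', w.edgeAt o₀ (k + 1) l l' ∈ P →
          w.edgeAt o₀ (k + 1) l l' = w.edgeAt o₀ (k + 1) (a k) i' := by
        intro l l' h
        by_cases hl : l = a k
        · refine hu _ ⟨h, (w.mem_edgeAt o₀).2 (Or.inl ?_)⟩
          rw [hl]
          rfl
        -- An edge starting at the other lower end would meet the edge already found at level `k`.
        · have h3 : w.edgeAt o₀ (k + 1) l l' = w.matchingEdge o₀ a k := by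
            refine huniq _ (w.isSnakeVertex_diagonalEnd o₀ hk (a k)) _ h _ h1 ?_
              ((w.mem_edgeAt o₀).2 (Or.inr rfl))
            refine (w.mem_edgeAt o₀).2 (Or.inl ?_)
            rw [lowerEnd, ← eq_add_one_of_ne (Ne.symm hl)]
          exact absurd (edgeAt_index_eq h3) (by omega)
      have h0 := ha (k + 1) (a k) i' he hu'
      have h3 : w.matchingEdge o₀ a (k + 1) = w.edgeAt o₀ (k + 1) (a k) i' := by
        rw [matchingEdge, h0]
        rfl
      rw [h3]
      exact ⟨he, hu'⟩
  have hidx : ∀ k < w.len, w.IsEdgeIndex o₀ (k + 1) (a k) (a (k + 1)) := by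
    intro k hk
    obtain ⟨j, hj, i, i', hi, h⟩ := hsnake _ (key (k + 1) hk).1
    obtain rfl := edgeAt_index_eq h
    rw [show a k = i from edgeAt_lower_eq h, edgeAt_upper_eq h]
    exact hi
  refine ⟨a, ⟨?_, fun k hk => (hidx k hk).1⟩, ?_⟩
  · have hlen : w.len - 1 + 1 = w.len := by have := w.len_pos; omega
    have := (hidx (w.len - 1) (by omega)).2 hlen
    rwa [hlen] at this
  · ext e
    rw [mem_matchingOf]
    constructor
    · intro he
      obtain ⟨j, hj, i, i', hi, rfl⟩ := hsnake e he
      exact ⟨j, hj, (key j hj).2 i i' he⟩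
    · rintro ⟨j, hj, rfl⟩
      exact (key j hj).1

/-! ## The alternating path -/

/-- The path has no choice: by disjointness a vertex determines its edge of the matching, and each
diagonal is traversed to its other end. -/
theorem IsAlternatingPath.eq_ends {a : ℕ → Fin 2} {v : ℕ → ℤ × ℤ}
    (hv : w.IsAlternatingPath o₀ (w.matchingOf o₀ a) v) (k : ℕ) (hk : k ≤ w.len) :
    v (2 * k) = w.lowerEnd o₀ k (a (k - 1)) ∧ v (2 * k + 1) = w.diagonalEnd o₀ k (a k) := by
  have step : ∀ k ≤ w.len, v (2 * k) = w.lowerEnd o₀ k (a (k - 1)) →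
      v (2 * k + 1) = w.diagonalEnd o₀ k (a k) := by
    intro k hk h
    obtain ⟨e, he, hes⟩ := hv.2.2.1 k hk
    obtain ⟨j, hj, rfl⟩ := mem_matchingOf.1 he
    have h1 : v (2 * k) ∈ (w.matchingEdge o₀ a j).1 := by simp [hes]
    have h2 : v (2 * k) ∈ (w.matchingEdge o₀ a k).1 := (w.mem_edgeAt o₀).2 (Or.inl h)
    obtain rfl := index_eq_of_mem_of_mem h1 h2
    rw [matchingEdge, edgeAt, h] at hes
    exact (Sym2.congr_right.1 hes).symm
  induction k with
  | zero =>
    -- The truncated index `0 - 1` is harmless, since `lowerEnd 0` ignores its second argument.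
    have h0 : v (2 * 0) = w.lowerEnd o₀ 0 (a (0 - 1)) := hv.1
    exact ⟨h0, step 0 hk h0⟩
  | succ k ih =>
    have h := (ih (by omega)).2
    have hd := hv.2.2.2 k hk
    have h0 : v (2 * (k + 1)) = w.lowerEnd o₀ (k + 1) (a (k + 1 - 1)) := by
      rw [h] at hd
      rw [Nat.add_sub_cancel, lowerEnd]
      rcases eq_zero_or_eq_one (a k) with h' | h' <;> rw [h'] at hd ⊢
      · exact Sym2.congr_right.1 hd
      · rw [Sym2.eq_swap (a := w.cornerNW o₀ k)] at hd
        exact Sym2.congr_right.1 hd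
    exact ⟨h0, step _ hk h0⟩

theorem IsAdmissible.exists_alternatingPath {a : ℕ → Fin 2} (ha : w.IsAdmissible o₀ a) :
    ∃ v, w.IsAlternatingPath o₀ (w.matchingOf o₀ a) v := by
  let v : ℕ → ℤ × ℤ := fun m =>
    if Even m then w.lowerEnd o₀ (m / 2) (a (m / 2 - 1)) else w.diagonalEnd o₀ (m / 2) (a (m / 2))
  have h0 : ∀ k, v (2 * k) = w.lowerEnd o₀ k (a (k - 1)) := fun k => by simp [v]
  have h1 : ∀ k, v (2 * k + 1) = w.diagonalEnd o₀ k (a k) := fun k => by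
    have : (2 * k + 1) / 2 = k := by omega
    simp [v, this]
  have hlen : w.len - 1 + 1 = w.len := by have := w.len_pos; omega
  refine ⟨v, h0 0, ?_, fun k hk => ?_, fun k hk => ?_⟩
  · rw [h1, ha.1, ← diagonalEnd_glueIndex, hlen]
  · refine ⟨_, mem_matchingOf.2 ⟨k, hk, rfl⟩, ?_⟩
    rw [h0, h1]
    rfl
  · rw [show 2 * k + 2 = 2 * (k + 1) by ring, h0, h1, Nat.add_sub_cancel, lowerEnd]
    rcases eq_zero_or_eq_one (a k) with h' | h' <;> rw [h']
    · rfl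
    · exact Sym2.eq_swap

theorem IsAdmissible.diagonalDown_iff {a : ℕ → Fin 2} (ha : w.IsAdmissible o₀ a) {k : ℕ}
    (hk : k ≤ w.len) : w.DiagonalDown o₀ (w.matchingOf o₀ a) k ↔ a k = 0 := by
  constructor
  · rintro ⟨v, hv, h⟩
    rw [(hv.eq_ends k hk).2] at h
    exact diagonalEnd_inj (h.trans (if_pos rfl).symm)
  · intro h
    obtain ⟨v, hv⟩ := ha.exists_alternatingPath
    exact ⟨v, hv, by rw [(hv.eq_ends k hk).2, h]; rfl⟩

theorem IsAdmissible.diagonalUp_iff {a : ℕ → Fin 2} (ha : w.IsAdmissible o₀ a) {k : ℕ}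
    (hk : k ≤ w.len) : w.DiagonalUp o₀ (w.matchingOf o₀ a) k ↔ a k = 1 := by
  constructor
  · rintro ⟨v, hv, h⟩
    rw [(hv.eq_ends k hk).2] at h
    exact diagonalEnd_inj (h.trans (if_neg (by decide)).symm)
  · intro h
    obtain ⟨v, hv⟩ := ha.exists_alternatingPath
    exact ⟨v, hv, by rw [(hv.eq_ends k hk).2, h]; rfl⟩

end CrossingSequence

/-! ## Matrix products as sums over paths -/

/-- The indicator sequence of a finite set: `0` on the set and `1` off it. -/
def indexSeq (A : Finset ℕ) (k : ℕ) : Fin 2 := if k ∈ A then 0 else 1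

/-- Index sequences of length `m + 1` are encoded as subsets of `range (m + 1)`, so that the
expansion becomes a sum over a powerset. -/
theorem matrix_prod_eq_sum (B Q : ℕ → Matrix (Fin 2) (Fin 2) K) (h0 : Q 0 = 1)
    (hQ : ∀ k, Q (k + 1) = B k * Q k) (m : ℕ) (b c : Fin 2) :
    Q m b c = ∑ A ∈ (Finset.range (m + 1)).powerset,
      if indexSeq A 0 = c ∧ indexSeq A m = b then
        ∏ k ∈ Finset.range m, B k (indexSeq A (k + 1)) (indexSeq A k) else 0 := by
  induction m generalizing b with
  | zero =>
    rw [h0, Finset.range_add_one, Finset.sum_powerset_insert (by simp), Finset.range_zero,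
      Finset.powerset_empty, Finset.sum_singleton, Finset.sum_singleton]
    fin_cases b <;> fin_cases c <;> simp [indexSeq]
  | succ m ih =>
    rw [Finset.range_add_one, Finset.sum_powerset_insert (by simp), ← Finset.sum_add_distrib, hQ,
      Matrix.mul_apply, Fin.sum_univ_two, ih, ih, Finset.mul_sum, Finset.mul_sum,
      ← Finset.sum_add_distrib]
    refine Finset.sum_congr rfl fun A hA => ?_
    -- A set without `m + 1` gives last index 1, the set with it inserted gives 0; earlier indices
    -- agree.
    have hA' : m + 1 ∉ A := fun h => by simpa using Finset.mem_powerset.1 hA h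
    have h1 : indexSeq A (m + 1) = 1 := if_neg hA'
    have h2 : indexSeq (insert (m + 1) A) (m + 1) = 0 := if_pos (by simp)
    have h3 : ∀ k ≤ m, indexSeq (insert (m + 1) A) k = indexSeq A k := fun k hk => by
      simp only [indexSeq, Finset.mem_insert, show k ≠ m + 1 by omega, false_or]
    have h4 : ∏ k ∈ Finset.range m,
        B k (indexSeq (insert (m + 1) A) (k + 1)) (indexSeq (insert (m + 1) A) k) =
        ∏ k ∈ Finset.range m, B k (indexSeq A (k + 1)) (indexSeq A k) :=
      Finset.prod_congr rfl fun k hk => by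
        have := Finset.mem_range.1 hk
        rw [h3 k (by omega), h3 (k + 1) (by omega)]
    rw [Finset.prod_range_succ, Finset.prod_range_succ, h4, h1, h2, h3 0 (Nat.zero_le _),
      h3 m le_rfl]
    rcases CrossingSequence.eq_zero_or_eq_one (indexSeq A m) with h | h <;> rw [h] <;>
      by_cases hc : indexSeq A 0 = c <;>
      fin_cases b <;> simp [hc, mul_comm]

theorem sum_matrix_prod_perm (B Q : ℕ → Matrix (Fin 2) (Fin 2) K) (h0 : Q 0 = 1)
    (hQ : ∀ k, Q (k + 1) = B k * Q k) (m : ℕ) (σ : Fin 2 → Fin 2) :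
    ∑ i, Q (m + 1) (σ i) i = ∑ A ∈ (Finset.range (m + 1)).powerset,
      (∏ k ∈ Finset.range m, B k (indexSeq A (k + 1)) (indexSeq A k)) *
        B m (σ (indexSeq A 0)) (indexSeq A m) := by
  simp only [hQ, Matrix.mul_apply, matrix_prod_eq_sum B Q h0 hQ m, Finset.mul_sum]
  simp only [Fin.sum_univ_two, ← Finset.sum_add_distrib]
  refine Finset.sum_congr rfl fun A _ => ?_
  rcases CrossingSequence.eq_zero_or_eq_one (indexSeq A m) with h | h <;>
    rcases CrossingSequence.eq_zero_or_eq_one (indexSeq A 0) with h' | h' <;>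
    simp [h, h', mul_comm]

namespace CrossingSequence

variable {w : S.CrossingSequence} {o₀ : ℤˣ}

/-! ## Closing up the snake graph -/

/-- The vanishing entry is that of the one pair of ends not joined by an edge. -/
theorem transferMatrix_apply (x : S.Edge → K) (k : ℕ) (i i' : Fin 2) :
    w.transferMatrix o₀ x k i' i =
      if i = w.glueIndex o₀ k ∨ i' = w.glueIndex o₀ k then
        x (S.edge (w.edgeSide o₀ (k + 1) i i')) else 0 := by
  by_cases h : w.GlueEast o₀ k <;>
    rcases eq_zero_or_eq_one i with rfl | rfl <;> rcases eq_zero_or_eq_one i' with rfl | rfl <;>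
    simp [transferMatrix, glueIndex, edgeSide, h]

variable (w o₀) in
open Classical in
/-- The end of the first diagonal on the glued edge of the first tile. -/
noncomputable def firstGluedIndex : Fin 2 :=
  if S.opp (w.side (w.len - 1)) = w.southSide o₀ 0 then 0 else 1

theorem firstGluedEdge_eq (i : Fin 2) :
    w.firstGluedEdge o₀ = w.edgeAt o₀ 0 i (w.firstGluedIndex o₀) := by
  unfold firstGluedEdge firstGluedIndex
  split_ifs
  · exact w.westEdge_zero o₀ i
  · exact w.southEdge_zero o₀ i

theorem lastGluedEdge_eq :
    w.lastGluedEdge o₀ = w.edgeAt o₀ w.len (w.glueIndex o₀ (w.len - 1))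
      (w.glueIndex o₀ (w.len - 1)) := by
  obtain ⟨m, hm⟩ : ∃ m, w.len = m + 1 := ⟨w.len - 1, by have := w.len_pos; omega⟩
  rw [lastGluedEdge, hm, Nat.add_sub_cancel]
  split_ifs with h
  · rw [eastEdge_eq]
    simp [glueIndex, h]
  · rw [northEdge_eq]
    simp [glueIndex, h]

/-- Tile `len` of the infinite snake graph is tile 0, reflected if `len` is even, so its south and
west sides are those of tile 0, possibly exchanged. This matches the last gluing with the first
tile: glued end, label of the glued edge, and label of the other lower edge. -/
theorem IsOneSided.closing (hw : w.IsOneSided) {m : ℕ} (hm : w.len = m + 1) :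
    w.closingPerm (w.firstGluedIndex o₀) = w.glueIndex o₀ m ∧
    S.edge (w.edgeSide o₀ 0 0 (w.firstGluedIndex o₀)) = S.edge (w.thirdSide o₀ m) ∧
    S.edge (w.edgeSide o₀ 0 0 (w.firstGluedIndex o₀ + 1)) = S.edge (w.side m) := by
  have hs : w.side (m + 1) = w.side 0 := by rw [← hm, side_len]
  have ho := hw.orientSW_len o₀
  have hsub : w.len - 1 = m := by omega
  rw [← edge_opp (w.side m)]
  -- This decides the test in `firstGluedIndex` when the last crossed side is the west one.
  have hsw : w.westSide o₀ 0 ≠ w.southSide o₀ 0 := by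
    intro h
    have h := congrArg Prod.snd h
    simp only [westSide, southSide] at h
    revert h
    rcases shift_eq_one_or_neg_one (w.orientSW o₀ 0) with h | h <;> rw [h] <;>
      generalize (w.side 0).2 = j <;> revert j <;> decide
  by_cases he : Even w.len
  · rw [he.neg_one_pow, one_mul, hm] at ho
    have h1 : w.southSide o₀ (m + 1) = w.westSide o₀ 0 := by
      rw [southSide, westSide, hs, ho, orientSW_zero, shift_neg, sub_eq_add_neg]
    have h2 : w.westSide o₀ (m + 1) = w.southSide o₀ 0 := by
      rw [southSide, westSide, hs, ho, orientSW_zero, shift_neg, sub_neg_eq_add]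
    by_cases h : w.GlueEast o₀ m
    · rw [southSide_succ_of_glueEast h] at h1
      rw [westSide_succ_of_glueEast h] at h2
      simp [closingPerm, he, firstGluedIndex, hsub, h1, h2, hsw, glueIndex, h, edgeSide]
    · rw [southSide_succ_of_not_glueEast h] at h1
      rw [westSide_succ_of_not_glueEast h] at h2
      simp [closingPerm, he, firstGluedIndex, hsub, h1, h2, glueIndex, h, edgeSide]
  · rw [(Nat.not_even_iff_odd.1 he).neg_one_pow, neg_one_mul, neg_neg, hm] at ho
    have h1 : w.southSide o₀ (m + 1) = w.southSide o₀ 0 := by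
      rw [southSide, southSide, hs, ho, orientSW_zero]
    have h2 : w.westSide o₀ (m + 1) = w.westSide o₀ 0 := by
      rw [westSide, westSide, hs, ho, orientSW_zero]
    by_cases h : w.GlueEast o₀ m
    · rw [southSide_succ_of_glueEast h] at h1
      rw [westSide_succ_of_glueEast h] at h2
      simp [closingPerm, he, firstGluedIndex, hsub, h1, h2, glueIndex, h, edgeSide]
    · rw [southSide_succ_of_not_glueEast h] at h1
      rw [westSide_succ_of_not_glueEast h] at h2
      simp [closingPerm, he, firstGluedIndex, hsub, h1, h2, hsw, glueIndex, h, edgeSide]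

/-! ## Weights -/

theorem firstGluedEdge_mem_matchingOf {a : ℕ → Fin 2} :
    w.firstGluedEdge o₀ ∈ w.matchingOf o₀ a ↔ a 0 = w.firstGluedIndex o₀ := by
  rw [firstGluedEdge_eq (a 0), mem_matchingOf]
  constructor
  · rintro ⟨j, -, h⟩
    obtain rfl := edgeAt_index_eq h
    exact (edgeAt_upper_eq h).symm
  · intro h
    exact ⟨0, Nat.zero_le _, by rw [matchingEdge, ← h]⟩

theorem IsAdmissible.lastGluedEdge_mem_matchingOf {a : ℕ → Fin 2} (ha : w.IsAdmissible o₀ a) :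
    w.lastGluedEdge o₀ ∈ w.matchingOf o₀ a ↔ a (w.len - 1) = w.glueIndex o₀ (w.len - 1) := by
  rw [lastGluedEdge_eq, mem_matchingOf]
  obtain ⟨m, hm⟩ : ∃ m, w.len = m + 1 := ⟨w.len - 1, by have := w.len_pos; omega⟩
  have h1 := ha.1
  rw [hm, Nat.add_sub_cancel] at h1 ⊢
  constructor
  · rintro ⟨j, -, h⟩
    obtain rfl := edgeAt_index_eq h
    exact (edgeAt_lower_eq h).symm
  · intro h
    exact ⟨m + 1, le_rfl, by rw [matchingEdge, h1, Nat.add_sub_cancel, h]⟩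

theorem prod_matchingOf (x : S.Edge → K) (a : ℕ → Fin 2) :
    ∏ e ∈ w.matchingOf o₀ a, x e.2 =
      ∏ j ∈ Finset.range (w.len + 1), x (S.edge (w.edgeSide o₀ j (a (j - 1)) (a j))) := by
  classical
  rw [matchingOf, Finset.prod_image fun _ _ _ _ h => matchingEdge_injective a h]
  rfl

/-- A diagonal oriented down or up selects the first or second diagonal entry of the crossing
matrix. On tiles with odd `k` the plane orientation is opposite to the carried one, which negates
the shear coordinate and gives the reversed rule. -/
theorem IsAdmissible.coefficientMonomial_matchingOf {a : ℕ → Fin 2} (ha : w.IsAdmissible o₀ a)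
    (L : S.PrincipalLamination) (y : S.Edge → K) :
    w.coefficientMonomial o₀ L y (w.matchingOf o₀ a) =
      ∏ k ∈ Finset.range w.len, crossMatrix L y (w.side k) (w.orientSW o₀ k) (a k) (a k) := by
  classical
  rw [coefficientMonomial, Finset.prod_filter]
  refine Finset.prod_congr rfl fun k hk => ?_
  have hk := (Finset.mem_range.1 hk).le
  simp only [IsLaminationOriented, ha.diagonalDown_iff hk, ha.diagonalUp_iff hk]
  rcases Nat.even_or_odd k with h | h
  · have h' : ¬ Odd k := Nat.not_odd_iff_even.2 h
    have ho : w.orientSW o₀ k = w.orient o₀ k := by rw [orientSW, h.neg_one_pow, one_mul]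
    rcases eq_zero_or_eq_one (a k) with e | e <;> rw [e] <;> simp [h, h', ho, crossMatrix]
  · have h' : ¬ Even k := Nat.not_even_iff_odd.2 h
    have ho : w.orientSW o₀ k = -w.orient o₀ k := by rw [orientSW, h.neg_one_pow, neg_one_mul]
    rcases eq_zero_or_eq_one (a k) with e | e <;> rw [e] <;>
      simp [h, h', ho, crossMatrix, PrincipalLamination.b_neg, neg_eq_iff_eq_neg]

/-! ### Good matchings as the nonzero terms of the twisted trace -/

variable (w o₀) in
/-- The sequence given by a subset of the tiles. -/
noncomputable def tileSeq (A : Finset ℕ) (k : ℕ) : Fin 2 :=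
  if k < w.len then indexSeq A k else w.glueIndex o₀ (w.len - 1)

theorem IsAdmissible.exists_eq_tileSeq {a : ℕ → Fin 2} (ha : w.IsAdmissible o₀ a) :
    ∃ A ∈ (Finset.range w.len).powerset, ∀ k ≤ w.len, a k = w.tileSeq o₀ A k := by
  refine ⟨(Finset.range w.len).filter fun k => a k = 0, by simp, fun k hk => ?_⟩
  rcases hk.lt_or_eq with hk | rfl
  · rcases eq_zero_or_eq_one (a k) with h | h <;> simp [tileSeq, indexSeq, hk, h]
  · simp [tileSeq, ha.1]

theorem isAdmissible_congr {a a' : ℕ → Fin 2} (h : ∀ k ≤ w.len, a k = a' k) :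
    w.IsAdmissible o₀ a ↔ w.IsAdmissible o₀ a' := by
  unfold IsAdmissible
  rw [h _ le_rfl]
  refine and_congr_right fun _ => forall₂_congr fun k hk => ?_
  rw [h k hk.le, h (k + 1) hk]

theorem matchingOf_congr {a a' : ℕ → Fin 2} (h : ∀ k ≤ w.len, a k = a' k) :
    w.matchingOf o₀ a = w.matchingOf o₀ a' := by
  classical
  refine Finset.image_congr fun j hj => ?_
  have hj : j ≤ w.len := by simpa using hj
  rw [matchingEdge, matchingEdge, h j hj, h (j - 1) (by omega)]

/-- Admissibility says that all transfer entries before the closing one are nonzero, and goodness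
says this of the closing entry. That entry is the product of the labels of the first and last edges
divided by the glued label. -/
theorem IsOneSided.goodMatchingEnumerator_eq (hw : w.IsOneSided) (L : S.PrincipalLamination)
    (x y : S.Edge → K) (hx : ∀ e, x e ≠ 0) :
    w.goodMatchingEnumerator o₀ L x y =
      ∑ i, w.transferProduct o₀ L x y w.len (w.closingPerm i) i := by
  classical
  obtain ⟨m, hm⟩ : ∃ m, w.len = m + 1 := ⟨w.len - 1, by have := w.len_pos; omega⟩
  obtain ⟨hc1, hc2, hc3⟩ := hw.closing (o₀ := o₀) hm
  have hsub : w.len - 1 = m := by omega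
  set g := w.firstGluedIndex o₀
  set c := w.glueIndex o₀ m with hc
  set B : ℕ → Matrix (Fin 2) (Fin 2) K := fun k =>
    w.transferMatrix o₀ x k * crossMatrix L y (w.side k) (w.orientSW o₀ k) with hB
  have hBapply : ∀ k i i', B k i' i = w.transferMatrix o₀ x k i' i *
      crossMatrix L y (w.side k) (w.orientSW o₀ k) i i := by
    intro k i i'
    simp only [hB]
    rw [Matrix.mul_apply, Fin.sum_univ_two]
    rcases eq_zero_or_eq_one i with rfl | rfl <;> simp [crossMatrix]
  rw [hm, sum_matrix_prod_perm B _ (by rw [transferProduct]) (fun k => by rw [transferProduct]) m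
    w.closingPerm, ← hm]
  have hseq : ∀ A, ∀ k ≤ m, w.tileSeq o₀ A k = indexSeq A k := fun A k hk =>
    if_pos (by omega)
  have hlast : ∀ A, w.tileSeq o₀ A (m + 1) = c := fun A => by
    rw [tileSeq, if_neg (by omega), hsub]
  symm
  -- The terms outside this filter have a vanishing transfer entry; the others correspond to good
  -- matchings.
  refine (Finset.sum_subset (s₁ := (Finset.range w.len).powerset.filter fun A =>
    w.IsAdmissible o₀ (w.tileSeq o₀ A) ∧ (indexSeq A 0 = g ∨ indexSeq A m = c))
    (Finset.filter_subset _ _) fun A hA hA' => ?_).symm.trans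
    (Finset.sum_bij (fun A _ => w.matchingOf o₀ (w.tileSeq o₀ A)) ?_ ?_ ?_ ?_)
  · have hA' : ¬ (w.IsAdmissible o₀ (w.tileSeq o₀ A) ∧ (indexSeq A 0 = g ∨ indexSeq A m = c)) :=
      fun h => hA' (Finset.mem_filter.2 ⟨hA, h⟩)
    by_cases hadm : w.IsAdmissible o₀ (w.tileSeq o₀ A)
    · have hgood := not_or.1 fun h => hA' ⟨hadm, h⟩
      have : w.closingPerm (indexSeq A 0) ≠ c := by
        rw [← hc1]
        exact w.closingPerm.injective.ne hgood.1
      rw [hBapply, transferMatrix_apply, if_neg (not_or.2 ⟨hgood.2, this⟩), zero_mul, mul_zero]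
    · have : ∃ k < m, ¬ (indexSeq A k = w.glueIndex o₀ k ∨
          indexSeq A (k + 1) = w.glueIndex o₀ k) := by
        by_contra! hcon
        refine hadm ⟨by rw [hsub, hm, hlast], fun k hk => ?_⟩
        rcases (show k ≤ m by omega).lt_or_eq with hk | rfl
        · rw [hseq A k hk.le, hseq A (k + 1) hk]
          exact hcon k hk
        · exact Or.inr (hlast A)
      obtain ⟨k, hk, h⟩ := this
      rw [Finset.prod_eq_zero (Finset.mem_range.2 hk), zero_mul]
      rw [hBapply, transferMatrix_apply, if_neg h, zero_mul]
  · intro A hA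
    obtain ⟨-, hadm, hgood⟩ := Finset.mem_filter.1 hA
    have hpm := hadm.isPerfectMatching
    refine Finset.mem_filter.2 ⟨Finset.mem_powerset.2 hpm.1, hpm, ?_⟩
    rwa [firstGluedEdge_mem_matchingOf, hadm.lastGluedEdge_mem_matchingOf, hsub,
      hseq A 0 (Nat.zero_le _), hseq A m le_rfl]
  · intro A hA A' hA' h
    have hA := Finset.mem_powerset.1 (Finset.mem_filter.1 hA).1
    have hA' := Finset.mem_powerset.1 (Finset.mem_filter.1 hA').1
    ext k
    by_cases hk : k < w.len
    · have h' := matchingOf_inj h hk.le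
      rw [hseq _ k (by omega), hseq _ k (by omega)] at h'
      by_cases h1 : k ∈ A <;> by_cases h2 : k ∈ A' <;> simp_all [indexSeq]
    · exact ⟨fun h => absurd (Finset.mem_range.1 (hA h)) hk,
        fun h => absurd (Finset.mem_range.1 (hA' h)) hk⟩
  · intro P hP
    obtain ⟨-, hpm, hgood⟩ := Finset.mem_filter.1 hP
    obtain ⟨a, ha, rfl⟩ := hpm.exists_eq_matchingOf
    obtain ⟨A, hA, hAa⟩ := ha.exists_eq_tileSeq
    have ha' := (isAdmissible_congr hAa).1 ha
    refine ⟨A, Finset.mem_filter.2 ⟨hA, ha', ?_⟩, (matchingOf_congr hAa).symm⟩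
    rw [matchingOf_congr hAa] at hgood
    rwa [firstGluedEdge_mem_matchingOf, ha'.lastGluedEdge_mem_matchingOf, hsub,
      hseq A 0 (Nat.zero_le _), hseq A m le_rfl] at hgood
  · intro A hA
    obtain ⟨-, hadm, hgood⟩ := Finset.mem_filter.1 hA
    have hprod : (∏ k ∈ Finset.range m, B k (indexSeq A (k + 1)) (indexSeq A k)) =
        (∏ k ∈ Finset.range m, x (S.edge (w.edgeSide o₀ (k + 1) (w.tileSeq o₀ A k)
          (w.tileSeq o₀ A (k + 1))))) * ∏ k ∈ Finset.range m,
          crossMatrix L y (w.side k) (w.orientSW o₀ k) (w.tileSeq o₀ A k) (w.tileSeq o₀ A k) := by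
      rw [← Finset.prod_mul_distrib]
      refine Finset.prod_congr rfl fun k hk => ?_
      have hk := Finset.mem_range.1 hk
      have h := hadm.2 k (by omega)
      rw [hBapply, ← hseq A k hk.le, ← hseq A (k + 1) hk, transferMatrix_apply, if_pos h]
    have hfirst : (w.firstGluedEdge o₀).2 = S.edge (w.thirdSide o₀ m) := by
      rw [firstGluedEdge_eq 0, ← hc2]
      rfl
    have hthird := hx (S.edge (w.thirdSide o₀ m))
    -- One of the two extreme edges is a copy of the glued edge and cancels with the denominator;
    -- the label of the other is the closing entry.
    have hclose : x (S.edge (w.edgeSide o₀ 0 0 (indexSeq A 0))) *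
        x (S.edge (w.edgeSide o₀ (m + 1) (indexSeq A m) c)) / x (S.edge (w.thirdSide o₀ m)) =
        w.transferMatrix o₀ x m (w.closingPerm (indexSeq A 0)) (indexSeq A m) := by
      rw [transferMatrix_apply]
      by_cases h0 : indexSeq A 0 = g
      · rw [h0, hc1, if_pos (Or.inr rfl), hc2]
        field_simp
      · have h1 : indexSeq A m = c := hgood.resolve_left h0
        have h2 : w.closingPerm (indexSeq A 0) ≠ c := by
          rw [← hc1]
          exact w.closingPerm.injective.ne h0
        rw [h1, if_pos (Or.inl rfl), eq_add_one_of_ne h0, hc3]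
        rw [eq_add_one_of_ne h0] at h2
        simp only [edgeSide, ← hc, if_true, if_neg h2]
        field_simp
    -- Of the `m + 2` edges the first and the last are split off for `hclose`; the `m` others are
    -- the factors in `hprod`.
    rw [hprod, hBapply, ← hclose, weight, hadm.coefficientMonomial_matchingOf, prod_matchingOf,
      hfirst, Finset.prod_range_succ', hm, Finset.prod_range_succ, Finset.prod_range_succ]
    simp only [Nat.add_sub_cancel, hlast]
    rw [hseq A m le_rfl, Nat.zero_sub, hseq A 0 (Nat.zero_le _)]
    have h00 : w.edgeSide o₀ 0 (indexSeq A 0) (indexSeq A 0) =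
      w.edgeSide o₀ 0 0 (indexSeq A 0) := rfl
    rw [h00]
    ring

/-- Transfer and crossing matrices have only labels, powers of y and zeros as entries. This
nonnegativity is what lets the absolute value of the trace determine the sum. -/
theorem transferProduct_nonneg [LinearOrder K] [IsStrictOrderedRing K] (L : S.PrincipalLamination)
    (x y : S.Edge → K) (hx : ∀ e, 0 < x e) (hy : ∀ e, 0 < y e) (k : ℕ) (i j : Fin 2) :
    0 ≤ w.transferProduct o₀ L x y k i j := by
  induction k generalizing i j with
  | zero =>
    rw [transferProduct, Matrix.one_apply]
    split_ifs <;> simp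
  | succ k ih =>
    have h1 : ∀ i j, 0 ≤ w.transferMatrix o₀ x k i j := by
      intro i j
      rw [transferMatrix_apply]
      split_ifs
      · exact (hx _).le
      · exact le_rfl
    have h2 : ∀ i j, 0 ≤ crossMatrix L y (w.side k) (w.orientSW o₀ k) i j := by
      intro i j
      have := (hy (S.edge (w.side k))).le
      fin_cases i <;> fin_cases j <;> simp [crossMatrix] <;> split_ifs <;> simp [this]
    rw [transferProduct, Matrix.mul_apply]
    refine Finset.sum_nonneg fun l _ => mul_nonneg ?_ (ih _ _)
    rw [Matrix.mul_apply]
    exact Finset.sum_nonneg fun l' _ => mul_nonneg (h1 _ _) (h2 _ _)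

end CrossingSequence

end TriangleGluing

theorem mainTheorem1 {X : Type*} [TopologicalSpace X] {M : Set X}
    (T : SurfaceTriangulation X M) (L : T.gluing.PrincipalLamination)
    (α : C(AddCircle (1 : ℝ), X)) (w : T.gluing.CrossingSequence)
    (hw : T.HasCrossingSequence α w) (hα : w.IsOneSided)
    (o : T.gluing.LocalOrientation) (o₀ : ℤˣ)
    {K : Type*} [Field K] [LinearOrder K] [IsStrictOrderedRing K]
    (x y : T.gluing.Edge → K) (hx : ∀ e, 0 < x e) (hy : ∀ e, 0 < y e) :
    (∃ ρ : T.gluing.StepPath, ρ.IsMPath w) ∧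
      ∀ ρ : T.gluing.StepPath, ρ.IsMPath w →
        |(ρ.matrix L x y o).trace| =
          1 / w.crossingMonomial x * w.goodMatchingEnumerator o₀ L x y := by
  refine ⟨⟨_, hα.isMPath_standardPath o₀⟩, fun ρ hρ => ?_⟩
  have hx' : ∀ e, x e ≠ 0 := fun e => (hx e).ne'
  obtain ⟨u, hu⟩ := hρ.trace_matrix (hα.isMPath_standardPath o₀) L x y hx' o
  obtain ⟨u', hu'⟩ := hα.trace_standardPath o₀ L x y hx'
  have hpos : 0 ≤ (w.crossingMonomial x)⁻¹ *
      ∑ i, w.transferProduct o₀ L x y w.len (w.closingPerm i) i :=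
    mul_nonneg (inv_nonneg.2 (Finset.prod_nonneg fun _ _ => (hx _).le))
      (Finset.sum_nonneg fun _ _ =>
        TriangleGluing.CrossingSequence.transferProduct_nonneg L x y hx hy _ _ _)
  have hsign : ∀ u : ℤˣ, |((u : ℤ) : K)| = 1 := fun u => by
    rcases Int.units_eq_one_or u with rfl | rfl <;> simp
  rw [hu, hu', abs_mul, abs_mul, hsign, hsign, one_mul, one_mul, abs_of_nonneg hpos, one_div,
    hα.goodMatchingEnumerator_eq L x y hx']
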